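/- **Setting.** Let $\alpha>1$ and let $\gamma=(\gamma_j)_{j\ge1}$ be weights with $1\ge\gamma_1\ge\gamma_2\ge\cdots>0$. Put $r_{\alpha,w}(0)=1$, $r_{\alpha,w}(h)=w/|h|^\alpha$ for $h\in\mathbb Z\setminus\{0\}$, and $r_d(h)=\prod_{j=1}^d r_{\alpha,\gamma_j}(h_j)$ for $h\in\mathbb Z^d$. The weighted Korobov space $\mathcal H_d$ is the reproducing kernel Hilbert space of functions $f:[0,1]^d\to\mathbb C$ with kernel $K_d(x,y)=\sum_{h\in\mathbb Z^d}r_d(h)\,e^{2\pi i h\cdot(x-y)}$, i.e. the space of sums of Fourier series with $\|f\|_d^2=\sum_{h\in\mathbb Z^d}|\widehat f(h)|^2/r_d(h)<\infty$. For $n\in\mathbb N_0$ let $e(n,\mathrm{APP}_{d,\infty},\Lambda)$ be the infimum, over all linear algorithms $A(f)=\sum_{i=1}^nT_i(f)g_i$ with $g_i\in L_\infty([0,1]^d)$ and $T_i\in\Lambda$, of the worst-case errors $\sup_{\|f\|_d\le1}\|f-A(f)\|_{L_\infty([0,1]^d)}$. Here $\Lambda$ is either $\Lambda^{\mathrm{all}}=\mathcal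 H_d^*$ (all bounded linear functionals) or $\Lambda^{\mathrm{std}}$ (all point evaluations). For $\varepsilon\in(0,1)$ the information complexity is $n(\varepsilon,d)=\min\{n\in\mathbb N_0: e(n,\mathrm{APP}_{d,\infty},\Lambda)\le\varepsilon\,\mathrm{CRI}_d\}$, where $\mathrm{CRI}_d=1$ for the absolute error criterion and $\mathrm{CRI}_d=\sup_{\|f\|_d\le1}\|f\|_{L_\infty}$ for the normalized error criterion. For a class $\Lambda$ and a criterion, the problem $\mathrm{APP}_\infty=(\mathrm{APP}_{d,\infty})_{d\ge1}$ is * *strongly polynomially tractable* if there are $\tau,C\ge0$ with $n(\varepsilon,d)\le C\varepsilon^{-\tau}$ for all $d\in\mathbb N$, $\varepsilon\in(0,1)$; * *polynomially tractable* if there are $\tau,\sigma,C\ge0$ with $n(\varepsilon,d)\le C\varepsilon^{-\tau}d^{\sigma}$ for all $d\in\mathbb N$, $\varepsilon\in(0,1)$; * *quasi-polynomially tractable* if there are $t,C\ge0$ with $n(\varepsilon,d)\le C\exp(t(1+\ln d)(1+\ln\varepsilon^{-1}))$ for all $d\in\mathbb N$, $\varepsilon\in(0,1)$; * *$(\sigma,\tau)$-weakly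 tractable* ($\sigma,\tau>0$) if $\ln n(\varepsilon,d)/(d^\sigma+\varepsilon^{-\tau})\to0$ as $d+\varepsilon^{-1}\to\infty$; * *weakly tractable* if $\ln n(\varepsilon,d)/(d+\varepsilon^{-1})\to0$ as $d+\varepsilon^{-1}\to\infty$; * *uniformly weakly tractable* if it is $(\sigma,\tau)$-weakly tractable for all $\sigma,\tau\in(0,1]$. With $\inf\emptyset=\infty$, put $$s_\gamma=\inf\Big\{\kappa>0:\sum_{j=1}^\infty\gamma_j^\kappa<\infty\Big\},\quad t_\gamma=\inf\Big\{\kappa>0:\limsup_{d\to\infty}\tfrac1{\ln(d+1)}\sum_{j=1}^d\gamma_j^\kappa<\infty\Big\},$$ $$u_{\gamma,\sigma}=\inf\Big\{\kappa>0:\lim_{d\to\infty}\tfrac1{d^\sigma}\sum_{j=1}^d\gamma_j^\kappa=0\Big\}\quad(\sigma>0).$$ **Theorem.** The following holds for each of the classes $\Lambda^{\mathrm{all}}$ and $\Lambda^{\mathrm{std}}$ and for both the normalized and the absolute error criterion. 1. $\mathrm{APP}_\infty$ is strongly polynomially tractable if and only if $s_\gamma<1$. If this holds, then for every $\tau\in(\max(1/\alpha,s_\gamma),1)$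 $$e(n,\mathrm{APP}_{d,\infty},\Lambda^{\mathrm{all}})=\mathcal O\big(n^{-(1-\tau)/(2\tau)}\big),\qquad e(n,\mathrm{APP}_{d,\infty},\Lambda^{\mathrm{std}})=\mathcal O\big(n^{-(1-\tau)/(2\tau(1+\tau))}\big),$$ with implied factors independent of $n,d\ge1$. 2. $\mathrm{APP}_\infty$ is polynomially tractable if and only if $t_\gamma<1$. If this holds, then for every $\tau\in(\max(1/\alpha,t_\gamma),1)$ and every $\delta>0$ $$e(n,\mathrm{APP}_{d,\infty},\Lambda^{\mathrm{all}})=\mathcal O\big(n^{-(1-\tau)/(2\tau)}d^{\,\delta+\zeta(\alpha\tau)t_\gamma/\tau}\big),\qquad e(n,\mathrm{APP}_{d,\infty},\Lambda^{\mathrm{std}})=\mathcal O\big(n^{-(1-\tau)/(2\tau(1+\tau))}d^{\,\delta+\zeta(\alpha\tau)t_\gamma/\tau}\big),$$ with implied factors independent of $n,d\ge1$, where $\zeta$ is the Riemann zeta function. 3. Quasi-polynomial tractability implies $\limsup_{d\to\infty}\frac1{\ln(d+1)}\sum_{j=1}^d\gamma_j<\infty$, and this condition implies $t_\gamma\le1$.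 4. Weak tractability implies $\lim_{d\to\infty}\frac1d\sum_{j=1}^d\gamma_j=0$, and this condition implies $u_{\gamma,1}\le1$. If $u_{\gamma,1}<1$, then weak tractability holds. 5. Let $\sigma\in(0,1]$ and $\tau>0$. Then $(\sigma,\tau)$-weak tractability implies $\lim_{d\to\infty}\frac1{d^\sigma}\sum_{j=1}^d\gamma_j=0$, and this condition implies $u_{\gamma,\sigma}\le1$. If $u_{\gamma,\sigma}<1$, then $(\sigma,\tau)$-weak tractability holds. For $\sigma>1$ and $\tau>0$, $(\sigma,\tau)$-weak tractability holds for all weights $1\ge\gamma_1\ge\gamma_2\ge\cdots>0$. 6. Uniform weak tractability implies $\lim_{d\to\infty}\frac1{d^\sigma}\sum_{j=1}^d\gamma_j=0$ for all $\sigma\in(0,1]$, and this condition implies $u_{\gamma,\sigma}\le1$ for all $\sigma\in(0,1]$. If $u_{\gamma,\sigma}<1$ for all $\sigma\in(0,1]$, then uniform weak tractability holds. -/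

import Mathlib

open Filter MeasureTheory Topology
open scoped ENNReal

noncomputable section

namespace Korobov

/-- The unit cube `[0,1]^d`, with its Lebesgue measure `volume`. -/
abbrev Cube (d : ℕ) : Type := Fin d → unitInterval

/-- The decay function `r_{α,γ}` on `ℤ`: `1` at `0`, and `γ / |h|^α` for `h ≠ 0`. -/
def decay (α w : ℝ) (h : ℤ) : ℝ :=
  if h = 0 then 1 else w / |(h : ℝ)| ^ α

/-- The product decay function `r_{d,α,γ}(h) = ∏_{j=1}^d r_{α,γ_j}(h_j)`. The weight `γ_{j+1}`
of the mathematical sequence `γ_1, γ_2, …` is `γ j`. -/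
def decayProd (α : ℝ) (γ : ℕ → ℝ) {d : ℕ} (h : Fin d → ℤ) : ℝ :=
  ∏ j : Fin d, decay α (γ j) (h j)

/-- The character `x ↦ exp(2πi h · x)` on the cube. -/
def character {d : ℕ} (h : Fin d → ℤ) (x : Cube d) : ℂ :=
  Complex.exp (2 * (Real.pi : ℂ) * Complex.I *
    ∑ j : Fin d, (h j : ℂ) * (((x j : unitInterval) : ℝ) : ℂ))

/-- The Fourier coefficient `∫_{[0,1]^d} f(x) exp(-2πi h · x) dx`. -/
def fourierCoef {d : ℕ} (f : Cube d → ℂ) (h : Fin d → ℤ) : ℂ :=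
  ∫ x : Cube d, f x * character (-h) x

theorem continuous_character {d : ℕ} (h : Fin d → ℤ) : Continuous (character h) := by
  unfold character
  fun_prop

theorem fourierCoef_add {d : ℕ} {f g : Cube d → ℂ} (hf : Continuous f) (hg : Continuous g)
    (h : Fin d → ℤ) : fourierCoef (f + g) h = fourierCoef f h + fourierCoef g h := by
  unfold fourierCoef
  have hc := continuous_character (-h)
  rw [← integral_add]
  · simp only [Pi.add_apply, add_mul]
  · exact (hf.mul hc).integrable_of_hasCompactSupport (HasCompactSupport.of_compactSpace _)
  · exact (hg.mul hc).integrable_of_hasCompactSupport (HasCompactSupport.of_compactSpace _)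

theorem fourierCoef_smul {d : ℕ} (c : ℂ) (f : Cube d → ℂ) (h : Fin d → ℤ) :
    fourierCoef (c • f) h = c * fourierCoef f h := by
  unfold fourierCoef
  rw [← integral_const_mul]
  simp only [Pi.smul_apply, smul_eq_mul, mul_assoc]

/-- The weighted Korobov space `H_{d,α,γ}`: the (continuous) functions on the cube that are the
sum of their Fourier series and for which `∑_h |f^(h)|² / r_{d,α,γ}(h)` is finite. For `α > 1`
this is the reproducing kernel Hilbert space of
`K(x,y) = ∑_h r_{d,α,γ}(h) exp(2πi h · (x-y))`. -/
def Space (α : ℝ) (γ : ℕ → ℝ) (d : ℕ) : Submodule ℂ (Cube d → ℂ) where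
  carrier := {f | Continuous f ∧
    Summable (fun h : Fin d → ℤ => ‖fourierCoef f h‖ ^ 2 / decayProd α γ h) ∧
    ∀ x, HasSum (fun h : Fin d → ℤ => fourierCoef f h * character h x) (f x)}
  zero_mem' := by
    have h0 : ∀ h : Fin d → ℤ, fourierCoef (0 : Cube d → ℂ) h = 0 := fun h => by
      simp [fourierCoef]
    refine ⟨continuous_const, ?_, fun x => ?_⟩
    · simp [h0]
    · simp [h0]
  add_mem' := by
    rintro f g ⟨hf, hfs, hft⟩ ⟨hg, hgs, hgt⟩
    refine ⟨hf.add hg, ?_, fun x => ?_⟩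
    · refine Summable.of_norm_bounded ((hfs.norm.add hgs.norm).mul_left 2) (fun h => ?_)
      rw [fourierCoef_add hf hg, norm_div, norm_div, norm_div, ← add_div, ← mul_div_assoc]
      refine div_le_div_of_nonneg_right ?_ (norm_nonneg _)
      simp only [norm_pow, norm_norm]
      have h1 := norm_add_le (fourierCoef f h) (fourierCoef g h)
      have h2 := pow_le_pow_left₀ (norm_nonneg _) h1 2
      nlinarith [sq_nonneg (‖fourierCoef f h‖ - ‖fourierCoef g h‖)]
    · simp only [fourierCoef_add hf hg, add_mul, Pi.add_apply]
      exact (hft x).add (hgt x)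
  smul_mem' := by
    rintro c f ⟨hf, hfs, hft⟩
    refine ⟨hf.const_smul c, ?_, fun x => ?_⟩
    · simp only [fourierCoef_smul, norm_mul, mul_pow, mul_div_assoc]
      exact hfs.mul_left _
    · simp only [fourierCoef_smul, mul_assoc, Pi.smul_apply, smul_eq_mul]
      exact (hft x).mul_left c

/-- The norm `‖f‖_{d,α,γ} = (∑_h |f^(h)|² / r_{d,α,γ}(h))^{1/2}` of the Korobov space. -/
def korobovNorm {α : ℝ} {γ : ℕ → ℝ} {d : ℕ} (f : Space α γ d) : ℝ :=
  Real.sqrt (∑' h : Fin d → ℤ, ‖fourierCoef (f : Cube d → ℂ) h‖ ^ 2 / decayProd α γ h)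

/-- The two classes of information: `Λ^all` and `Λ^std`. -/
inductive InfoClass
  | all
  | std

/-- The linear functionals in an information class: all bounded linear functionals for `Λ^all`,
point evaluations for `Λ^std`. -/
def InfoClass.Admits (L : InfoClass) {α : ℝ} {γ : ℕ → ℝ} {d : ℕ} (T : Space α γ d →ₗ[ℂ] ℂ) : Prop :=
  match L with
  | .all => ∃ C : ℝ, ∀ f, ‖T f‖ ≤ C * korobovNorm f
  | .std => ∃ x : Cube d, ∀ f : Space α γ d, T f = (f : Cube d → ℂ) x

/-- The worst-case `L_∞` error, over the unit ball of the Korobov space, of the linear algorithm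
`A(f) = ∑_{i=1}^n T_i(f) g_i` (`eLpNorm _ ∞` is the essential supremum norm). -/
def worstCaseError {α : ℝ} {γ : ℕ → ℝ} {d n : ℕ} (T : Fin n → (Space α γ d →ₗ[ℂ] ℂ))
    (g : Fin n → Cube d → ℂ) : ℝ≥0∞ :=
  ⨆ (f : Space α γ d) (_ : korobovNorm f ≤ 1),
    eLpNorm (fun x => (f : Cube d → ℂ) x - ∑ i, T i f * g i x) ∞ volume

/-- The `n`-th minimal worst-case error `e(n, APP_{d,∞}, Λ)`. -/
def minimalError (α : ℝ) (γ : ℕ → ℝ) (d : ℕ) (L : InfoClass) (n : ℕ) : ℝ≥0∞ :=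
  ⨅ (T : Fin n → (Space α γ d →ₗ[ℂ] ℂ)) (g : Fin n → Cube d → ℂ)
    (_ : ∀ i, L.Admits (T i)) (_ : ∀ i, MemLp (g i) ∞ volume), worstCaseError T g

/-- The initial error `e(0, APP_{d,∞}) = ‖APP_{d,∞}‖`. -/
def initialError (α : ℝ) (γ : ℕ → ℝ) (d : ℕ) : ℝ≥0∞ :=
  ⨆ (f : Space α γ d) (_ : korobovNorm f ≤ 1), eLpNorm (f : Cube d → ℂ) ∞ volume

/-- The absolute and the normalized error criterion. -/
inductive Criterion
  | absolute
  | normalized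

/-- The normalizing factor: `1` for the absolute criterion, the initial error for the normalized
one. -/
def Criterion.factor (c : Criterion) (α : ℝ) (γ : ℕ → ℝ) (d : ℕ) : ℝ≥0∞ :=
  match c with
  | .absolute => 1
  | .normalized => initialError α γ d

/-- The information complexity `n(ε, APP_{d,∞}, Λ)`: the least `n` with
`e(n, APP_{d,∞}, Λ) ≤ ε CRI_d` (`⊤` if there is none). -/
def infoComplexity (α : ℝ) (γ : ℕ → ℝ) (L : InfoClass) (c : Criterion) (d : ℕ) (ε : ℝ) : ℕ∞ :=
  ⨅ (n : ℕ) (_ : minimalError α γ d L n ≤ ENNReal.ofReal ε * c.factor α γ d), (n : ℕ∞)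

/-- Strong polynomial tractability. -/
def IsSPT (α : ℝ) (γ : ℕ → ℝ) (L : InfoClass) (c : Criterion) : Prop :=
  ∃ τ C : ℝ, 0 ≤ τ ∧ 0 ≤ C ∧ ∀ d : ℕ, 1 ≤ d → ∀ ε : ℝ, 0 < ε → ε < 1 →
    (infoComplexity α γ L c d ε : ℝ≥0∞) ≤ ENNReal.ofReal (C * ε ^ (-τ))

/-- Polynomial tractability. -/
def IsPT (α : ℝ) (γ : ℕ → ℝ) (L : InfoClass) (c : Criterion) : Prop :=
  ∃ τ σ C : ℝ, 0 ≤ τ ∧ 0 ≤ σ ∧ 0 ≤ C ∧ ∀ d : ℕ, 1 ≤ d → ∀ ε : ℝ, 0 < ε → ε < 1 →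
    (infoComplexity α γ L c d ε : ℝ≥0∞) ≤ ENNReal.ofReal (C * ε ^ (-τ) * (d : ℝ) ^ σ)

/-- Quasi-polynomial tractability. -/
def IsQPT (α : ℝ) (γ : ℕ → ℝ) (L : InfoClass) (c : Criterion) : Prop :=
  ∃ t C : ℝ, 0 ≤ t ∧ 0 ≤ C ∧ ∀ d : ℕ, 1 ≤ d → ∀ ε : ℝ, 0 < ε → ε < 1 →
    (infoComplexity α γ L c d ε : ℝ≥0∞) ≤
      ENNReal.ofReal (C * Real.exp (t * (1 + Real.log d) * (1 + Real.log ε⁻¹)))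

/-- The filter `d + ε⁻¹ → ∞` on pairs `(d, ε)` with `d ≥ 1` and `0 < ε < 1`. -/
def dimAccuracyFilter : Filter (ℕ × ℝ) :=
  comap (fun p : ℕ × ℝ => (p.1 : ℝ) + p.2⁻¹) atTop ⊓
    𝓟 {p : ℕ × ℝ | 1 ≤ p.1 ∧ 0 < p.2 ∧ p.2 < 1}

/-- `(σ,τ)`-weak tractability: `ln n(ε, APP_{d,∞}, Λ) / (d^σ + ε^{-τ}) → 0` as
`d + ε⁻¹ → ∞`. -/
def IsWeaklyTractable (σ τ α : ℝ) (γ : ℕ → ℝ) (L : InfoClass) (c : Criterion) : Prop :=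
  Tendsto (fun p : ℕ × ℝ => ENNReal.log (infoComplexity α γ L c p.1 p.2 : ℝ≥0∞) /
    (((p.1 : ℝ) ^ σ + p.2 ^ (-τ) : ℝ) : EReal)) dimAccuracyFilter (𝓝 0)

/-- Weak tractability. -/
def IsWT (α : ℝ) (γ : ℕ → ℝ) (L : InfoClass) (c : Criterion) : Prop :=
  Tendsto (fun p : ℕ × ℝ => ENNReal.log (infoComplexity α γ L c p.1 p.2 : ℝ≥0∞) /
    (((p.1 : ℝ) + p.2⁻¹ : ℝ) : EReal)) dimAccuracyFilter (𝓝 0)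

/-- Uniform weak tractability. -/
def IsUWT (α : ℝ) (γ : ℕ → ℝ) (L : InfoClass) (c : Criterion) : Prop :=
  ∀ σ τ : ℝ, 0 < σ → σ ≤ 1 → 0 < τ → τ ≤ 1 → IsWeaklyTractable σ τ α γ L c

/-- `limsup_{d → ∞} (1 / ln(d+1)) ∑_{j=1}^d γ_j^κ < ∞`. -/
def LogSumBounded (γ : ℕ → ℝ) (κ : ℝ) : Prop :=
  limsup (fun d : ℕ =>
    ((1 / Real.log ((d : ℝ) + 1) * ∑ j ∈ Finset.range d, γ j ^ κ : ℝ) : EReal)) atTop < ⊤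

/-- `lim_{d → ∞} (1 / d^σ) ∑_{j=1}^d γ_j^κ = 0`. -/
def PowSumVanishes (γ : ℕ → ℝ) (σ κ : ℝ) : Prop :=
  Tendsto (fun d : ℕ => 1 / (d : ℝ) ^ σ * ∑ j ∈ Finset.range d, γ j ^ κ) atTop (𝓝 0)

/-- The sum exponent `s_γ` (`⊤` if there is no admissible `κ`). -/
def sExponent (γ : ℕ → ℝ) : EReal :=
  sInf ((fun κ : ℝ => (κ : EReal)) '' {κ : ℝ | 0 < κ ∧ Summable fun j => γ j ^ κ})

/-- The exponent `t_γ` (`⊤` if there is no admissible `κ`). -/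
def tExponent (γ : ℕ → ℝ) : EReal :=
  sInf ((fun κ : ℝ => (κ : EReal)) '' {κ : ℝ | 0 < κ ∧ LogSumBounded γ κ})

/-- The exponent `u_{γ,σ}` (`⊤` if there is no admissible `κ`). -/
def uExponent (γ : ℕ → ℝ) (σ : ℝ) : EReal :=
  sInf ((fun κ : ℝ => (κ : EReal)) '' {κ : ℝ | 0 < κ ∧ PowSumVanishes γ σ κ})

/-- The real number `ζ(x)`, for real `x > 1`. -/
def zetaReal (x : ℝ) : ℝ := (riemannZeta (x : ℂ)).re

end Korobov

end

noncomputable section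

namespace Korobov

theorem norm_character {d : ℕ} (h : Fin d → ℤ) (x : Cube d) : ‖character h x‖ = 1 := by
  unfold character
  have : 2 * (Real.pi : ℂ) * Complex.I * ∑ j : Fin d, (h j : ℂ) * (((x j : unitInterval) : ℝ) : ℂ)
      = ((2 * Real.pi * ∑ j : Fin d, (h j : ℝ) * ((x j : unitInterval) : ℝ) : ℝ) : ℂ)
        * Complex.I := by
    push_cast; ring
  rw [this, Complex.norm_exp_ofReal_mul_I]

theorem enorm_character {d : ℕ} (h : Fin d → ℤ) (x : Cube d) : ‖character h x‖ₑ = 1 := by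
  rw [← ofReal_norm, norm_character, ENNReal.ofReal_one]

theorem character_add {d : ℕ} (h k : Fin d → ℤ) (x : Cube d) :
    character (h + k) x = character h x * character k x := by
  unfold character
  rw [← Complex.exp_add, ← mul_add, ← Finset.sum_add_distrib]
  simp [add_mul]

theorem character_zero {d : ℕ} (x : Cube d) : character (0 : Fin d → ℤ) x = 1 := by
  simp [character]

theorem conj_character {d : ℕ} (h : Fin d → ℤ) (x : Cube d) :
    (starRingEnd ℂ) (character h x) = character (-h) x := by
  unfold character
  rw [← Complex.exp_conj]
  simp [Complex.conj_ofReal, show (starRingEnd ℂ) 2 = 2 from map_ofNat _ 2]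

theorem integral_exp_unitInterval (n : ℤ) :
    ∫ t : unitInterval, Complex.exp (2 * (Real.pi : ℂ) * Complex.I * ((n : ℂ) * ((t : ℝ) : ℂ)))
      = if n = 0 then 1 else 0 := by
  have h1 : ∫ t : unitInterval,
      Complex.exp (2 * (Real.pi : ℂ) * Complex.I * ((n : ℂ) * ((t : ℝ) : ℂ)))
      = ∫ t in (0 : ℝ)..1, Complex.exp ((2 * (Real.pi : ℂ) * Complex.I * n) * t) := by
    rw [intervalIntegral.integral_of_le zero_le_one, ← integral_Icc_eq_integral_Ioc,
      ← integral_subtype_comap measurableSet_Icc]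
    simp only [mul_assoc]
    rfl
  rw [h1]
  split_ifs with hn
  · simp [hn]
  · have hc : 2 * (Real.pi : ℂ) * Complex.I * n ≠ 0 := by
      simp [Real.pi_ne_zero, Complex.I_ne_zero, hn]
    rw [integral_exp_mul_complex hc]
    have : Complex.exp (2 * (Real.pi : ℂ) * Complex.I * n) = 1 := by
      rw [← Complex.exp_int_mul_two_pi_mul_I n]; ring_nf
    simp [this]

theorem integral_character {d : ℕ} (h : Fin d → ℤ) :
    ∫ x : Cube d, character h x = if h = 0 then 1 else 0 := by
  have h1 : ∀ x : Cube d, character h x = ∏ j : Fin d,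
      Complex.exp (2 * (Real.pi : ℂ) * Complex.I * ((h j : ℂ) * (((x j : unitInterval) : ℝ) : ℂ))) := by
    intro x
    rw [← Complex.exp_sum, ← Finset.mul_sum]; rfl
  simp only [h1]
  rw [integral_fintype_prod_volume_eq_prod (E := fun _ : Fin d => unitInterval)
    (fun j (t : unitInterval) =>
      Complex.exp (2 * (Real.pi : ℂ) * Complex.I * ((h j : ℂ) * ((t : ℝ) : ℂ))))]
  simp only [integral_exp_unitInterval]
  by_cases hh : h = 0
  · simp [hh]
  · rw [if_neg hh]
    obtain ⟨j, hj⟩ := Function.ne_iff.mp hh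
    exact Finset.prod_eq_zero (Finset.mem_univ j) (if_neg hj)

theorem integrable_of_continuous {d : ℕ} {f : Cube d → ℂ} (hf : Continuous f) :
    Integrable f volume :=
  hf.integrable_of_hasCompactSupport (HasCompactSupport.of_compactSpace _)

theorem fourierCoef_character {d : ℕ} (k h : Fin d → ℤ) :
    fourierCoef (character k) h = if h = k then 1 else 0 := by
  unfold fourierCoef
  simp only [← character_add, integral_character, add_neg_eq_zero]
  simp [eq_comm]

theorem decay_pos {α w : ℝ} (hw : 0 < w) (h : ℤ) : 0 < decay α w h := by
  unfold decay
  split_ifs with h0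
  · exact one_pos
  · have : 0 < |(h : ℝ)| := abs_pos.mpr (by exact_mod_cast h0)
    positivity

theorem decay_le_one {α w : ℝ} (hα : 0 < α) (hw : w ≤ 1) (h : ℤ) :
    decay α w h ≤ 1 := by
  unfold decay
  split_ifs with h0
  · exact le_rfl
  · have h1 : 1 ≤ |(h : ℝ)| := by
      exact_mod_cast Int.one_le_abs h0
    have h2 : 1 ≤ |(h : ℝ)| ^ α := Real.one_le_rpow h1 hα.le
    rw [div_le_one (by positivity)]
    linarith

theorem decayProd_pos {α : ℝ} {γ : ℕ → ℝ} (hγ : ∀ j, 0 < γ j) {d : ℕ} (h : Fin d → ℤ) :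
    0 < decayProd α γ h :=
  Finset.prod_pos fun j _ => decay_pos (hγ j) (h j)

theorem decayProd_le_one {α : ℝ} (hα : 0 < α) {γ : ℕ → ℝ} (hγ : ∀ j, 0 < γ j)
    (hγ1 : ∀ j, γ j ≤ 1) {d : ℕ} (h : Fin d → ℤ) : decayProd α γ h ≤ 1 :=
  Finset.prod_le_one (fun j _ => (decay_pos (hγ j) (h j)).le)
    fun j _ => decay_le_one hα (hγ1 j) (h j)

theorem decayProd_zero {α : ℝ} {γ : ℕ → ℝ} {d : ℕ} : decayProd α γ (0 : Fin d → ℤ) = 1 := by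
  simp [decayProd, decay]

theorem character_mem_space (α : ℝ) (γ : ℕ → ℝ) {d : ℕ} (k : Fin d → ℤ) :
    character k ∈ Space α γ d := by
  refine ⟨continuous_character k, ?_, fun x => ?_⟩
  · refine summable_of_ne_finset_zero (s := {k}) fun h hh => ?_
    rw [Finset.notMem_singleton] at hh
    simp [fourierCoef_character, hh]
  · have := hasSum_single (f := fun h => fourierCoef (character k) h * character h x) k
      (fun h hh => by simp [fourierCoef_character, hh])
    simpa [fourierCoef_character] using this

/-- The character `e_k` as an element of the Korobov space. -/
def charElt (α : ℝ) (γ : ℕ → ℝ) {d : ℕ} (k : Fin d → ℤ) : Space α γ d :=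
  ⟨character k, character_mem_space α γ k⟩

/-- Cauchy–Schwarz for sums of extended nonnegative reals. -/
theorem tsum_mul_sq_le {ι : Type*} (f g : ι → ℝ≥0∞) :
    (∑' i, f i * g i) ^ 2 ≤ (∑' i, f i ^ 2) * ∑' i, g i ^ 2 := by
  let _ : MeasurableSpace ι := ⊤
  have h := ENNReal.lintegral_mul_le_Lp_mul_Lq (Measure.count : Measure ι)
    (Real.HolderConjugate.two_two) (f := f) (g := g)
    (Measurable.of_discrete.aemeasurable) (Measurable.of_discrete.aemeasurable)
  have h2 := pow_le_pow_left' h 2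
  rw [mul_pow, ← ENNReal.rpow_natCast, ← ENNReal.rpow_natCast, ← ENNReal.rpow_natCast,
    ← ENNReal.rpow_mul, ← ENNReal.rpow_mul] at h2
  simp only [lintegral_count] at h2
  simpa using h2

theorem tsum_prod_fin {d : ℕ} (f : Fin d → ℤ → ℝ≥0∞) :
    ∑' h : Fin d → ℤ, ∏ j, f j (h j) = ∏ j, ∑' n, f j n := by
  induction d with
  | zero => simp
  | succ d ih =>
    rw [← (Fin.consEquiv fun _ : Fin (d + 1) => ℤ).tsum_eq, Fin.prod_univ_succ,
      ← ih (fun j => f j.succ), ← ENNReal.tsum_mul_right]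
    refine (ENNReal.tsum_prod (f := fun n h => ∏ j, f j (Fin.cons n h j))).trans ?_
    refine tsum_congr fun n => ?_
    rw [← ENNReal.tsum_mul_left]
    refine tsum_congr fun h => ?_
    rw [Fin.prod_univ_succ]
    simp

theorem decayProd_rpow {α : ℝ} {γ : ℕ → ℝ} (hγ : ∀ j, 0 < γ j) {d : ℕ} (τ : ℝ) (h : Fin d → ℤ) :
    ENNReal.ofReal (decayProd α γ h ^ τ) =
      ∏ j : Fin d, ENNReal.ofReal (decay α (γ j) (h j) ^ τ) := by
  unfold decayProd
  rw [← Real.finsetProd_rpow _ _ (fun (j : Fin d) _ => (decay_pos (hγ j) (h j)).le),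
    ENNReal.ofReal_prod_of_nonneg]
  exact fun j _ => Real.rpow_nonneg (decay_pos (hγ j) (h j)).le _

/-- The sum `∑_{n ≠ 0} |n|^{-x}` over the integers. -/
def intZeta (x : ℝ) : ℝ := ∑' n : ℤ, |(n : ℝ)| ^ (-x)

theorem intZeta_nonneg (x : ℝ) : 0 ≤ intZeta x :=
  tsum_nonneg fun _ => Real.rpow_nonneg (abs_nonneg _) _

theorem tsum_decay_rpow_le {α w τ : ℝ} (hw : 0 < w) (hατ : 1 < α * τ) :
    ∑' n : ℤ, ENNReal.ofReal (decay α w n ^ τ) ≤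
      ENNReal.ofReal (Real.exp (intZeta (α * τ) * w ^ τ)) := by
  have hs : Summable fun n : ℤ => |(n : ℝ)| ^ (-(α * τ)) := Real.summable_abs_int_rpow hατ
  have hle : ∀ n : ℤ, ENNReal.ofReal (decay α w n ^ τ) ≤
      (if n = 0 then 1 else 0) + ENNReal.ofReal (w ^ τ * |(n : ℝ)| ^ (-(α * τ))) := by
    intro n
    unfold decay
    split_ifs with h0
    · simp
    · rw [zero_add, Real.div_rpow hw.le (by positivity), ← Real.rpow_mul (abs_nonneg _),
        Real.rpow_neg (abs_nonneg _), div_eq_mul_inv]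
  refine (ENNReal.tsum_le_tsum hle).trans ?_
  rw [ENNReal.tsum_add, tsum_ite_eq, ← ENNReal.ofReal_tsum_of_nonneg _ (hs.mul_left _),
    tsum_mul_left, ← ENNReal.ofReal_one, ← ENNReal.ofReal_add zero_le_one]
  · refine ENNReal.ofReal_le_ofReal ?_
    have := Real.add_one_le_exp (intZeta (α * τ) * w ^ τ)
    unfold intZeta at this ⊢
    linarith
  · exact mul_nonneg (by positivity) (intZeta_nonneg _)
  · intro n; positivity

theorem tsum_decayProd_rpow_le {α τ : ℝ} {γ : ℕ → ℝ} (hγ : ∀ j, 0 < γ j)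
    (hατ : 1 < α * τ) (d : ℕ) :
    ∑' h : Fin d → ℤ, ENNReal.ofReal (decayProd α γ h ^ τ) ≤
      ENNReal.ofReal (Real.exp (intZeta (α * τ) * ∑ j ∈ Finset.range d, γ j ^ τ)) := by
  simp only [decayProd_rpow hγ]
  rw [tsum_prod_fin (fun (j : Fin d) n => ENNReal.ofReal (decay α (γ j) n ^ τ)), Finset.mul_sum,
    Real.exp_sum, ENNReal.ofReal_prod_of_nonneg (fun _ _ => (Real.exp_pos _).le),
    ← Fin.prod_univ_eq_prod_range
      (fun j => ENNReal.ofReal (Real.exp (intZeta (α * τ) * γ j ^ τ)))]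
  exact Finset.prod_le_prod' fun j _ => tsum_decay_rpow_le (hγ j) hατ

theorem prod_one_add_le_tsum_decayProd {α : ℝ} {γ : ℕ → ℝ} (hγ : ∀ j, 0 < γ j) (d : ℕ) :
    ENNReal.ofReal (∏ j ∈ Finset.range d, (1 + γ j)) ≤
      ∑' h : Fin d → ℤ, ENNReal.ofReal (decayProd α γ h) := by
  have h1 : ∀ h : Fin d → ℤ, ENNReal.ofReal (decayProd α γ h) =
      ∏ j : Fin d, ENNReal.ofReal (decay α (γ j) (h j)) := fun h =>
    ENNReal.ofReal_prod_of_nonneg fun j _ => (decay_pos (hγ j) (h j)).le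
  simp only [h1]
  rw [tsum_prod_fin (fun (j : Fin d) n => ENNReal.ofReal (decay α (γ j) n)),
    ENNReal.ofReal_prod_of_nonneg (fun j _ => by have := hγ j; positivity),
    ← Fin.prod_univ_eq_prod_range (fun j => ENNReal.ofReal (1 + γ j))]
  refine Finset.prod_le_prod' fun j _ => ?_
  refine le_trans (le_of_eq ?_) (ENNReal.sum_le_tsum {0, 1})
  rw [Finset.sum_pair (by norm_num), ENNReal.ofReal_add zero_le_one (hγ j).le]
  simp [decay]

/-- Keeping the `m` largest values of the decay function leaves a small tail. -/
theorem exists_truncation {α τ M : ℝ} {γ : ℕ → ℝ} (hγ : ∀ j, 0 < γ j) (hτ : 0 < τ) (hτ1 : τ < 1)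
    (hM : 1 ≤ M) {d : ℕ}
    (hsum : ∑' h : Fin d → ℤ, ENNReal.ofReal (decayProd α γ h ^ τ) ≤ ENNReal.ofReal M)
    {m : ℕ} (hm : 1 ≤ m) :
    ∃ A : Finset (Fin d → ℤ), A.card ≤ m ∧
      ∑' h : Fin d → ℤ, (if h ∈ A then 0 else ENNReal.ofReal (decayProd α γ h)) ≤
        ENNReal.ofReal (M ^ (1 / τ) * (m : ℝ) ^ (-((1 - τ) / τ))) := by
  have hm0 : (0 : ℝ) < m := by exact_mod_cast hm
  have hM0 : 0 < M := by linarith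
  set t : ℝ := (M / m) ^ (1 / τ) with ht
  have ht0 : 0 < t := by positivity
  have htτ : t ^ τ = M / m := by
    rw [ht, ← Real.rpow_mul (by positivity), one_div_mul_cancel hτ.ne', Real.rpow_one]
  have hcard : ∀ B : Finset (Fin d → ℤ), (∀ h ∈ B, t < decayProd α γ h) → B.card ≤ m := by
    intro B hB
    have h1 : ENNReal.ofReal (B.card * t ^ τ) ≤ ENNReal.ofReal M := by
      refine le_trans ?_ ((ENNReal.sum_le_tsum B).trans hsum)
      rw [← ENNReal.ofReal_sum_of_nonneg
        (fun h _ => Real.rpow_nonneg (decayProd_pos hγ h).le _)]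
      refine ENNReal.ofReal_le_ofReal ?_
      rw [← nsmul_eq_mul]
      exact Finset.card_nsmul_le_sum _ _ _ fun h hh =>
        Real.rpow_le_rpow ht0.le (hB h hh).le hτ.le
    rw [ENNReal.ofReal_le_ofReal_iff hM0.le, htτ, ← mul_div_assoc, div_le_iff₀ hm0,
      mul_comm M] at h1
    exact_mod_cast le_of_mul_le_mul_right h1 hM0
  have hfin : {h : Fin d → ℤ | t < decayProd α γ h}.Finite := by
    by_contra hinf
    obtain ⟨B, hB, hBc⟩ := Set.Infinite.exists_subset_card_eq hinf (m + 1)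
    have := hcard B (fun h hh => hB hh)
    omega
  refine ⟨hfin.toFinset, hcard _ (fun h hh => by simpa using hh), ?_⟩
  have hle : ∀ h : Fin d → ℤ,
      (if h ∈ hfin.toFinset then 0 else ENNReal.ofReal (decayProd α γ h)) ≤
        ENNReal.ofReal (t ^ (1 - τ)) * ENNReal.ofReal (decayProd α γ h ^ τ) := by
    intro h
    split_ifs with hh
    · exact zero_le
    · have hh' : decayProd α γ h ≤ t := by simpa using hh
      have hp := decayProd_pos (α := α) hγ h
      rw [← ENNReal.ofReal_mul (by positivity)]
      refine ENNReal.ofReal_le_ofReal ?_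
      calc decayProd α γ h = decayProd α γ h ^ (1 - τ) * decayProd α γ h ^ τ := by
            rw [← Real.rpow_add hp]; simp
        _ ≤ _ := by gcongr
  refine (ENNReal.tsum_le_tsum hle).trans ?_
  rw [ENNReal.tsum_mul_left]
  refine (mul_le_mul_right hsum _).trans ?_
  rw [← ENNReal.ofReal_mul (by positivity)]
  refine ENNReal.ofReal_le_ofReal (le_of_eq ?_)
  have hdiv : t ^ (1 - τ) = M ^ ((1 - τ) / τ) * (m : ℝ) ^ (-((1 - τ) / τ)) := by
    rw [ht, ← Real.rpow_mul (by positivity), show 1 / τ * (1 - τ) = (1 - τ) / τ by ring,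
      Real.div_rpow hM0.le hm0.le, Real.rpow_neg hm0.le, div_eq_mul_inv]
  have hMM : M ^ (1 / τ) = M ^ ((1 - τ) / τ) * M := by
    rw [← Real.rpow_add_one hM0.ne']
    congr 1; field_simp; ring
  rw [hdiv, hMM]; ring

variable {α : ℝ} {γ : ℕ → ℝ} {d : ℕ}

/-- The functional `f ↦ f^(h)` on the Korobov space. -/
def fourierFunctional (α : ℝ) (γ : ℕ → ℝ) {d : ℕ} (h : Fin d → ℤ) : Space α γ d →ₗ[ℂ] ℂ where
  toFun f := fourierCoef (f : Cube d → ℂ) h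
  map_add' f g := fourierCoef_add f.2.1 g.2.1 h
  map_smul' c f := fourierCoef_smul c (f : Cube d → ℂ) h

/-- Point evaluation on the Korobov space. -/
def evalFunctional (α : ℝ) (γ : ℕ → ℝ) {d : ℕ} (x : Cube d) : Space α γ d →ₗ[ℂ] ℂ where
  toFun f := (f : Cube d → ℂ) x
  map_add' _ _ := rfl
  map_smul' _ _ := rfl

theorem korobovNorm_nonneg (f : Space α γ d) : 0 ≤ korobovNorm f := Real.sqrt_nonneg _

theorem tsum_enorm_fourierCoef_sq (hγ : ∀ j, 0 < γ j) (f : Space α γ d) :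
    ∑' h : Fin d → ℤ, ENNReal.ofReal (‖fourierCoef (f : Cube d → ℂ) h‖ ^ 2 / decayProd α γ h) =
      ENNReal.ofReal (korobovNorm f) ^ 2 := by
  have h0 : ∀ h : Fin d → ℤ, 0 ≤ ‖fourierCoef (f : Cube d → ℂ) h‖ ^ 2 / decayProd α γ h :=
    fun h => div_nonneg (sq_nonneg _) (decayProd_pos hγ h).le
  rw [← ENNReal.ofReal_tsum_of_nonneg h0 f.2.2.1, ← ENNReal.ofReal_pow (korobovNorm_nonneg f)]
  unfold korobovNorm
  rw [Real.sq_sqrt (tsum_nonneg h0)]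

theorem tsum_enorm_fourierCoef_mul_sq_le (hγ : ∀ j, 0 < γ j) (f : Space α γ d)
    (c : (Fin d → ℤ) → ℝ≥0∞) :
    (∑' h, ‖fourierCoef (f : Cube d → ℂ) h‖ₑ * c h) ^ 2 ≤
      ENNReal.ofReal (korobovNorm f) ^ 2 *
        ∑' h, ENNReal.ofReal (decayProd α γ h) * c h ^ 2 := by
  have h1 := tsum_mul_sq_le
    (fun h : Fin d → ℤ =>
      ENNReal.ofReal (‖fourierCoef (f : Cube d → ℂ) h‖ / Real.sqrt (decayProd α γ h)))
    (fun h => ENNReal.ofReal (Real.sqrt (decayProd α γ h)) * c h)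
  rw [← tsum_enorm_fourierCoef_sq hγ f]
  have hs : ∀ h : Fin d → ℤ, 0 < Real.sqrt (decayProd α γ h) := fun h =>
    Real.sqrt_pos.mpr (decayProd_pos hγ h)
  convert h1 using 2
  · refine tsum_congr fun h => ?_
    rw [← mul_assoc, ← ENNReal.ofReal_mul (div_nonneg (norm_nonneg _) (hs h).le),
      div_mul_cancel₀ _ (hs h).ne', ofReal_norm]
  · congr 1; ext h
    rw [← ENNReal.ofReal_pow (div_nonneg (norm_nonneg _) (hs h).le), div_pow,
      Real.sq_sqrt (decayProd_pos hγ h).le]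
  · congr 1; ext h
    rw [mul_pow, ← ENNReal.ofReal_pow (hs h).le, Real.sq_sqrt (decayProd_pos hγ h).le]

theorem enorm_le_tsum_of_hasSum {ι : Type*} {f : ι → ℂ} {s : ℂ} (hf : HasSum f s) :
    ‖s‖ₑ ≤ ∑' i, ‖f i‖ₑ :=
  hf.enorm_le_of_bounded ENNReal.summable.hasSum fun _ => le_rfl

/-- A functional given by coefficients `c` on the Fourier side is bounded by the norm of its
representer. -/
theorem enorm_sq_le_of_hasSum (hγ : ∀ j, 0 < γ j) (f : Space α γ d) {c : (Fin d → ℤ) → ℂ} {s : ℂ}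
    (hs : HasSum (fun h => fourierCoef (f : Cube d → ℂ) h * c h) s) :
    ‖s‖ₑ ^ 2 ≤ ENNReal.ofReal (korobovNorm f) ^ 2 *
        ∑' h, ENNReal.ofReal (decayProd α γ h) * ‖c h‖ₑ ^ 2 := by
  refine le_trans (pow_le_pow_left' (enorm_le_tsum_of_hasSum hs) 2) ?_
  simp only [enorm_mul]
  exact tsum_enorm_fourierCoef_mul_sq_le hγ f _

theorem enorm_apply_sq_le (hγ : ∀ j, 0 < γ j) (f : Space α γ d) (x : Cube d) :
    ‖(f : Cube d → ℂ) x‖ₑ ^ 2 ≤ ENNReal.ofReal (korobovNorm f) ^ 2 *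
        ∑' h : Fin d → ℤ, ENNReal.ofReal (decayProd α γ h) := by
  simpa [enorm_character] using enorm_sq_le_of_hasSum hγ f (f.2.2.2 x)

theorem admits_all_fourierFunctional (hγ : ∀ j, 0 < γ j) (h : Fin d → ℤ) :
    InfoClass.all.Admits (fourierFunctional α γ h) := by
  refine ⟨Real.sqrt (decayProd α γ h), fun f => ?_⟩
  have hp := decayProd_pos (α := α) hγ h
  have h1 : ‖fourierCoef (f : Cube d → ℂ) h‖ ^ 2 / decayProd α γ h ≤
      ∑' k : Fin d → ℤ, ‖fourierCoef (f : Cube d → ℂ) k‖ ^ 2 / decayProd α γ k :=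
    f.2.2.1.le_tsum h fun k _ => div_nonneg (sq_nonneg _) (decayProd_pos hγ k).le
  rw [div_le_iff₀' hp] at h1
  unfold korobovNorm
  rw [← Real.sqrt_mul hp.le]
  exact Real.le_sqrt_of_sq_le h1

theorem admits_all_evalFunctional (hγ : ∀ j, 0 < γ j)
    (hS : ∑' h : Fin d → ℤ, ENNReal.ofReal (decayProd α γ h) ≠ ⊤) (x : Cube d) :
    InfoClass.all.Admits (evalFunctional α γ x) := by
  refine ⟨Real.sqrt (∑' h : Fin d → ℤ, ENNReal.ofReal (decayProd α γ h)).toReal, fun f => ?_⟩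
  have h1 := enorm_apply_sq_le hγ f x
  rw [← ENNReal.ofReal_toReal hS, ← ofReal_norm, ← ENNReal.ofReal_pow (norm_nonneg _),
    ← ENNReal.ofReal_pow (korobovNorm_nonneg f), ← ENNReal.ofReal_mul (sq_nonneg _),
    ENNReal.ofReal_le_ofReal_iff (by positivity)] at h1
  refine (Real.le_sqrt_of_sq_le h1).trans (le_of_eq ?_)
  rw [Real.sqrt_mul (sq_nonneg _), Real.sqrt_sq (korobovNorm_nonneg f), mul_comm]

theorem exists_admits (L : InfoClass) (hγ : ∀ j, 0 < γ j) :
    ∃ T : Space α γ d →ₗ[ℂ] ℂ, L.Admits T := by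
  cases L with
  | all => exact ⟨_, admits_all_fourierFunctional hγ 0⟩
  | std => exact ⟨evalFunctional α γ (fun _ => 0), fun _ => 0, fun _ => rfl⟩

theorem minimalError_le_of_algorithm {L : InfoClass} (hγ : ∀ j, 0 < γ j) {N n : ℕ} (hNn : N ≤ n)
    (T : Fin N → (Space α γ d →ₗ[ℂ] ℂ)) (g : Fin N → Cube d → ℂ) (hT : ∀ i, L.Admits (T i))
    (hg : ∀ i, Continuous (g i)) {B : ℝ≥0∞}
    (hB : ∀ f : Space α γ d, korobovNorm f ≤ 1 → ∀ x,
      ‖(f : Cube d → ℂ) x - ∑ i, T i f * g i x‖ₑ ≤ B) :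
    minimalError α γ d L n ≤ B := by
  obtain ⟨r, rfl⟩ := Nat.exists_eq_add_of_le hNn
  obtain ⟨T₀, hT₀⟩ := exists_admits (α := α) (d := d) L hγ
  refine iInf_le_of_le (Fin.append T fun _ : Fin r => T₀)
    (iInf_le_of_le (Fin.append g fun _ : Fin r => 0) (iInf_le_of_le ?_ (iInf_le_of_le ?_ ?_)))
  · intro i
    refine Fin.addCases (fun i => ?_) (fun i => ?_) i
    · simpa using hT i
    · simpa using hT₀
  · intro i
    refine Fin.addCases (fun i => ?_) (fun i => ?_) i
    · obtain ⟨C, hC⟩ := (isCompact_univ (X := Cube d)).exists_bound_of_continuousOn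
        (hg i).continuousOn
      simpa using memLp_top_of_bound (hg i).aestronglyMeasurable C
        (Eventually.of_forall fun x => hC x (Set.mem_univ x))
    · simp
  · refine iSup_le fun f => iSup_le fun hf => ?_
    rw [eLpNorm_exponent_top]
    refine essSup_le_of_ae_le _ (Eventually.of_forall fun x => ?_)
    simpa [Fin.sum_univ_add] using hB f hf x

theorem minimalError_all_le_std (hγ : ∀ j, 0 < γ j)
    (hS : ∑' h : Fin d → ℤ, ENNReal.ofReal (decayProd α γ h) ≠ ⊤) (n : ℕ) :
    minimalError α γ d .all n ≤ minimalError α γ d .std n := by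
  refine le_iInf fun T => le_iInf fun g => le_iInf fun hT => le_iInf fun hg => ?_
  refine iInf_le_of_le T (iInf_le_of_le g (iInf_le_of_le (fun i => ?_) (iInf_le_of_le hg le_rfl)))
  obtain ⟨x, hx⟩ := hT i
  have : T i = evalFunctional α γ x := LinearMap.ext hx
  rw [this]
  exact admits_all_evalFunctional hγ hS x

theorem tsum_decayProd_le (hα : 0 < α) (hγ : ∀ j, 0 < γ j) (hγ1 : ∀ j, γ j ≤ 1) {τ : ℝ}
    (hτ1 : τ ≤ 1) :
    ∑' h : Fin d → ℤ, ENNReal.ofReal (decayProd α γ h) ≤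
      ∑' h : Fin d → ℤ, ENNReal.ofReal (decayProd α γ h ^ τ) :=
  ENNReal.tsum_le_tsum fun h => ENNReal.ofReal_le_ofReal <|
    Real.self_le_rpow_of_le_one (decayProd_pos hγ h).le (decayProd_le_one hα hγ hγ1 h) hτ1

theorem sq_le_of_le_rpow_half {x y : ℝ≥0∞} : x ≤ y ^ (2 : ℝ)⁻¹ ↔ x ^ 2 ≤ y := by
  rw [ENNReal.le_rpow_inv_iff two_pos, ENNReal.rpow_two]

theorem minimalError_sq_le_of_algorithm {L : InfoClass} (hγ : ∀ j, 0 < γ j) {N n : ℕ} (hNn : N ≤ n)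
    (T : Fin N → (Space α γ d →ₗ[ℂ] ℂ)) (g : Fin N → Cube d → ℂ) (hT : ∀ i, L.Admits (T i))
    (hg : ∀ i, Continuous (g i)) {B : ℝ≥0∞}
    (hB : ∀ f : Space α γ d, korobovNorm f ≤ 1 → ∀ x,
      ‖(f : Cube d → ℂ) x - ∑ i, T i f * g i x‖ₑ ^ 2 ≤ B) :
    minimalError α γ d L n ^ 2 ≤ B :=
  sq_le_of_le_rpow_half.mp <| minimalError_le_of_algorithm hγ hNn T g hT hg
    fun f hf x => sq_le_of_le_rpow_half.mpr (hB f hf x)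

theorem ofReal_korobovNorm_sq_mul_le {f : Space α γ d} (hf : korobovNorm f ≤ 1) (S : ℝ≥0∞) :
    ENNReal.ofReal (korobovNorm f) ^ 2 * S ≤ S := by
  refine mul_le_of_le_one_left' (pow_le_one' ?_ 2)
  simpa using hf

theorem minimalError_sq_le_tsum {L : InfoClass} (hγ : ∀ j, 0 < γ j) (n : ℕ) :
    (minimalError α γ d L n) ^ 2 ≤ ∑' h : Fin d → ℤ, ENNReal.ofReal (decayProd α γ h) := by
  refine minimalError_sq_le_of_algorithm hγ (zero_le) Fin.elim0 Fin.elim0 (fun i => i.elim0)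
      (fun i => i.elim0) fun f hf x => ?_
  simpa using (enorm_apply_sq_le hγ f x).trans (ofReal_korobovNorm_sq_mul_le hf _)

theorem initialError_sq_le (hγ : ∀ j, 0 < γ j) :
    (initialError α γ d) ^ 2 ≤ ∑' h : Fin d → ℤ, ENNReal.ofReal (decayProd α γ h) := by
  rw [← sq_le_of_le_rpow_half]
  refine iSup_le fun f => iSup_le fun hf => ?_
  rw [eLpNorm_exponent_top]
  refine essSup_le_of_ae_le _ (Eventually.of_forall fun x => sq_le_of_le_rpow_half.mpr ?_)
  exact (enorm_apply_sq_le hγ f x).trans (ofReal_korobovNorm_sq_mul_le hf _)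

theorem one_le_initialError : 1 ≤ initialError α γ d := by
  refine le_iSup₂_of_le (charElt α γ (0 : Fin d → ℤ)) ?_ ?_
  · refine (Real.sqrt_le_one).mpr (le_of_eq ?_)
    rw [tsum_eq_single (0 : Fin d → ℤ)]
    · simp [charElt, fourierCoef_character, decayProd_zero]
    · intro h hh
      simp [charElt, fourierCoef_character, hh]
  · have : ((charElt α γ (0 : Fin d → ℤ) : Space α γ d) : Cube d → ℂ) = fun _ => (1 : ℂ) := by
      funext x; exact character_zero x
    rw [this, eLpNorm_const _ (by simp) (NeZero.ne _)]
    simp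

theorem minimalError_all_sq_le_tail (hγ : ∀ j, 0 < γ j) (A : Finset (Fin d → ℤ)) {n : ℕ}
    (hA : A.card ≤ n) :
    (minimalError α γ d .all n) ^ 2 ≤
      ∑' h : Fin d → ℤ, (if h ∈ A then 0 else ENNReal.ofReal (decayProd α γ h)) := by
  refine minimalError_sq_le_of_algorithm hγ hA
    (fun i => fourierFunctional α γ (A.equivFin.symm i : Fin d → ℤ))
    (fun i => character (A.equivFin.symm i : Fin d → ℤ))
    (fun i => admits_all_fourierFunctional hγ _) (fun i => continuous_character _)
    fun f hf x => ?_
  have hsum : ∑ i : Fin A.card, fourierFunctional α γ (A.equivFin.symm i : Fin d → ℤ) f *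
      character (A.equivFin.symm i : Fin d → ℤ) x =
      ∑ h ∈ A, fourierCoef (f : Cube d → ℂ) h * character h x := by
    rw [← Finset.sum_coe_sort A, ← A.equivFin.symm.sum_comp]
    rfl
  rw [hsum]
  have h1 := hasSum_sum_of_ne_finset_zero (L := SummationFilter.unconditional _) (s := A)
    (f := fun h => if h ∈ A then fourierCoef (f : Cube d → ℂ) h * character h x else 0)
    (fun h hh => if_neg hh)
  have h2 := (f.2.2.2 x).sub h1
  rw [Finset.sum_congr rfl (fun h hh => if_pos hh)] at h2
  have h3 : HasSum (fun h => fourierCoef (f : Cube d → ℂ) h *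
      (if h ∈ A then 0 else character h x)) ((f : Cube d → ℂ) x -
        ∑ h ∈ A, fourierCoef (f : Cube d → ℂ) h * character h x) := by
    have e : ∀ h, fourierCoef (f : Cube d → ℂ) h * (if h ∈ A then 0 else character h x) =
        fourierCoef (f : Cube d → ℂ) h * character h x -
          (if h ∈ A then fourierCoef (f : Cube d → ℂ) h * character h x else 0) := fun h => by
      split_ifs <;> simp
    simp only [e]
    exact h2
  refine (enorm_sq_le_of_hasSum hγ f h3).trans ((ofReal_korobovNorm_sq_mul_le hf _).trans ?_)
  refine ENNReal.tsum_le_tsum fun h => ?_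
  split_ifs <;> simp [enorm_character]

theorem minimalError_all_le {τ M : ℝ} (hγ : ∀ j, 0 < γ j) (hτ : 0 < τ) (hτ1 : τ < 1)
    (hM : 1 ≤ M)
    (hsum : ∑' h : Fin d → ℤ, ENNReal.ofReal (decayProd α γ h ^ τ) ≤ ENNReal.ofReal M)
    {n : ℕ} (hn : 1 ≤ n) :
    minimalError α γ d .all n ≤
      ENNReal.ofReal (M ^ (1 / (2 * τ)) * (n : ℝ) ^ (-((1 - τ) / (2 * τ)))) := by
  obtain ⟨A, hA, hAt⟩ := exists_truncation hγ hτ hτ1 hM hsum hn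
  have hn0 : (0 : ℝ) < n := by exact_mod_cast hn
  have h1 := (minimalError_all_sq_le_tail hγ A hA).trans hAt
  refine (ENNReal.pow_le_pow_left_iff two_ne_zero).mp (h1.trans (le_of_eq ?_))
  rw [← ENNReal.ofReal_pow (by positivity), mul_pow, ← Real.rpow_natCast, ← Real.rpow_natCast,
    ← Real.rpow_mul (by positivity), ← Real.rpow_mul (by positivity)]
  congr 3 <;> push_cast <;> field_simp

theorem lintegral_enorm_sq_eq {f : Cube d → ℂ} (hf : Continuous f) :
    ∫⁻ y, ‖f y‖ₑ ^ 2 = ENNReal.ofReal (∫ y, ‖f y‖ ^ 2) := by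
  rw [ofReal_integral_eq_lintegral_ofReal]
  · simp only [ENNReal.ofReal_pow (norm_nonneg _), ofReal_norm]
  · exact (hf.norm.pow 2).integrable_of_hasCompactSupport (HasCompactSupport.of_compactSpace _)
  · exact Eventually.of_forall fun y => sq_nonneg _

/-- Pythagoras: a mean-zero function is orthogonal to the constants. -/
theorem lintegral_enorm_const_add_sq {f : Cube d → ℂ} (hf : Continuous f) (h0 : ∫ y, f y = 0)
    (s : ℂ) : ∫⁻ y, ‖s + f y‖ₑ ^ 2 = ‖s‖ₑ ^ 2 + ∫⁻ y, ‖f y‖ₑ ^ 2 := by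
  rw [lintegral_enorm_sq_eq hf, 
    lintegral_enorm_sq_eq (f := fun y => s + f y) (continuous_const.add hf), ← ofReal_norm,
    ← ENNReal.ofReal_pow (norm_nonneg _),
    ← ENNReal.ofReal_add (sq_nonneg _) (integral_nonneg fun y => sq_nonneg _)]
  congr 1
  have hi : Integrable (fun y => ‖f y‖ ^ 2) (volume : Measure (Cube d)) :=
    (hf.norm.pow 2).integrable_of_hasCompactSupport (HasCompactSupport.of_compactSpace _)
  have hic : Integrable (fun y => (starRingEnd ℂ) s * f y) (volume : Measure (Cube d)) :=
    integrable_of_continuous (continuous_const.mul hf)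
  have h1 : ∀ y, ‖s + f y‖ ^ 2 = ‖s‖ ^ 2 + 2 * ((starRingEnd ℂ) s * f y).re + ‖f y‖ ^ 2 := by
    intro y
    rw [Complex.sq_norm, Complex.sq_norm, Complex.sq_norm, Complex.normSq_add]
    simp only [Complex.mul_re, Complex.conj_re, Complex.conj_im]
    ring
  have hre : ∫ y, ((starRingEnd ℂ) s * f y).re = 0 := by
    have := integral_re hic
    simp only [RCLike.re_to_complex] at this
    rw [this, integral_const_mul, h0]
    simp
  have hir : Integrable (fun y => ((starRingEnd ℂ) s * f y).re) (volume : Measure (Cube d)) :=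
    hic.re
  simp only [h1]
  rw [integral_add _ hi, integral_add (integrable_const _) (hir.const_mul 2), integral_const_mul,
    hre]
  · simp
  · exact (integrable_const _).add (hir.const_mul 2)

/-- Sample points can be chosen greedily so that a family of mean-zero functions satisfies the
second-moment bound of independent sampling. -/
theorem exists_sample {ι : Type*} [Countable ι] (w : ι → ℝ≥0∞) (Z : ι → Cube d → ℂ)
    (hZ : ∀ i, Continuous (Z i)) (h0 : ∀ i, ∫ y, Z i y = 0) {V : ℝ≥0∞}
    (hV : ∑' i, w i * ∫⁻ y, ‖Z i y‖ₑ ^ 2 ≤ V) (n : ℕ) :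
    ∃ y : Fin n → Cube d, ∑' i, w i * ‖∑ l, Z i (y l)‖ₑ ^ 2 ≤ n * V := by
  induction n with
  | zero => exact ⟨Fin.elim0, by simp⟩
  | succ n ih =>
    obtain ⟨y, hy⟩ := ih
    have hc : ∀ i, Continuous fun t => ∑ l, Z i (y l) + Z i t := fun i =>
      continuous_const.add (hZ i)
    have hm : ∀ i, Measurable fun t => w i * ‖∑ l, Z i (y l) + Z i t‖ₑ ^ 2 := fun i =>
      ((hc i).enorm.measurable.pow_const 2).const_mul _
    obtain ⟨t, ht⟩ := exists_le_lintegral (μ := (volume : Measure (Cube d)))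
      (f := fun t => ∑' i, w i * ‖∑ l, Z i (y l) + Z i t‖ₑ ^ 2)
      (Measurable.tsum hm).aemeasurable
    refine ⟨Fin.snoc y t, ?_⟩
    simp only [Fin.sum_univ_castSucc, Fin.snoc_castSucc, Fin.snoc_last]
    refine ht.trans ?_
    rw [lintegral_tsum fun i => (hm i).aemeasurable]
    have : ∀ i, ∫⁻ t, w i * ‖∑ l, Z i (y l) + Z i t‖ₑ ^ 2 =
        w i * ‖∑ l, Z i (y l)‖ₑ ^ 2 + w i * ∫⁻ t, ‖Z i t‖ₑ ^ 2 := fun i => by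
      rw [lintegral_const_mul _ ((hc i).enorm.measurable.pow_const 2),
        lintegral_enorm_const_add_sq (hZ i) (h0 i), mul_add]
    simp only [this]
    rw [ENNReal.tsum_add, Nat.cast_succ, add_mul, one_mul]
    exact add_le_add hy hV

theorem integrable_const_mul_character (b : ℂ) (g : Fin d → ℤ) :
    Integrable (fun y => b * character g y) :=
  integrable_of_continuous (continuous_const.mul (continuous_character g))

/-- Parseval's identity for trigonometric polynomials. -/
theorem lintegral_enorm_trigPoly_sq (B : Finset (Fin d → ℤ)) (b : (Fin d → ℤ) → ℂ) :
    ∫⁻ y, ‖∑ g ∈ B, b g * character g y‖ₑ ^ 2 = ∑ g ∈ B, ‖b g‖ₑ ^ 2 := by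
  induction B using Finset.induction_on with
  | empty => simp
  | insert g B hg ih =>
    rw [Finset.sum_insert hg, ← ih]
    have hc : Continuous fun y => ∑ g ∈ B, b g * character g y :=
      continuous_finsetSum _ fun g _ => continuous_const.mul (continuous_character g)
    have hc' : Continuous fun y => (∑ g ∈ B, b g * character g y) * character (-g) y :=
      hc.mul (continuous_character _)
    have h1 : ∀ y, ‖∑ g ∈ insert g B, b g * character g y‖ₑ ^ 2 =
        ‖b g + (∑ g ∈ B, b g * character g y) * character (-g) y‖ₑ ^ 2 := by
      intro y
      rw [Finset.sum_insert hg, ← mul_one ‖b g + _‖ₑ, ← enorm_character g y, ← enorm_mul, add_mul,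
        mul_assoc, ← character_add, neg_add_cancel, character_zero, mul_one]
    have h2 : ∀ y, ‖(∑ g ∈ B, b g * character g y) * character (-g) y‖ₑ ^ 2 =
        ‖∑ g ∈ B, b g * character g y‖ₑ ^ 2 := by
      intro y
      rw [enorm_mul, enorm_character, mul_one]
    simp only [h1]
    rw [lintegral_enorm_const_add_sq hc']
    · simp only [h2]
    · simp only [Finset.sum_mul, mul_assoc, ← character_add]
      rw [integral_finsetSum _ fun g' _ => integrable_const_mul_character _ _]
      refine Finset.sum_eq_zero fun g' hg' => ?_
      rw [integral_const_mul, integral_character, if_neg, mul_zero]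
      rw [add_neg_eq_zero]
      rintro rfl
      exact hg hg'

/-- The sum of the values of the decay function outside of `A`. -/
def tail (α : ℝ) (γ : ℕ → ℝ) (A : Finset (Fin d → ℤ)) : ℝ≥0∞ :=
  ∑' h : Fin d → ℤ, (if h ∈ A then 0 else ENNReal.ofReal (decayProd α γ h))

/-- The squared Hilbert–Schmidt norm of the error, on the frequencies in `A`, of the approximation
of `f^(h)` by `∑ i, a h i * f (x i)`. -/
def sampleError (α : ℝ) (γ : ℕ → ℝ) (A : Finset (Fin d → ℤ)) {N : ℕ} (x : Fin N → Cube d)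
    (a : (Fin d → ℤ) → Fin N → ℂ) : ℝ≥0∞ :=
  ∑' k : Fin d → ℤ, ENNReal.ofReal (decayProd α γ k) *
    ∑ h ∈ A, ‖(if h = k then 1 else 0) - ∑ i, a h i * character k (x i)‖ₑ ^ 2

theorem exists_refinement (A A' : Finset (Fin d → ℤ)) {N : ℕ} (x : Fin N → Cube d)
    (a : (Fin d → ℤ) → Fin N → ℂ) {n : ℕ} (hn : 1 ≤ n) :
    ∃ (x' : Fin (N + n) → Cube d) (a' : (Fin d → ℤ) → Fin (N + n) → ℂ),
      n * sampleError α γ A' x' a' ≤ A'.card * (sampleError α γ A x a + tail α γ A) := by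
  classical
  set c : (Fin d → ℤ) → (Fin d → ℤ) → ℂ := fun k g => ∑ i, a g i * character k (x i) with hc
  set b : (Fin d → ℤ) → (Fin d → ℤ) → ℂ := fun k g =>
    (if g = k then 1 else 0) - (if g ∈ A then c k g else 0) with hb
  set G : (Fin d → ℤ) → Cube d → ℂ := fun k y =>
    character k y - ∑ g ∈ A, c k g * character g y with hG
  have hGc : ∀ k, Continuous (G k) := fun k => (continuous_character k).sub
    (continuous_finsetSum _ fun g _ => continuous_const.mul (continuous_character g))
  have hGsum : ∀ k y, G k y = ∑ g ∈ insert k A, b k g * character g y := by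
    intro k y
    simp only [hb, hG, sub_mul, Finset.sum_sub_distrib, ite_mul, one_mul, zero_mul]
    congr 1
    · rw [Finset.sum_ite_eq' (insert k A) k]; simp
    · rw [← Finset.sum_filter]
      refine Finset.sum_congr ?_ fun _ _ => rfl
      ext g; simp only [Finset.mem_filter, Finset.mem_insert]; tauto
  have hbA : ∀ k h, h ∉ insert k A → b k h = 0 := by
    intro k h hh
    rw [Finset.mem_insert, not_or] at hh
    simp [hb, hh.1, hh.2]
  have hint : ∀ k h, ∫ y, G k y * character (-h) y = b k h := by
    intro k h
    simp only [hGsum, Finset.sum_mul, mul_assoc, ← character_add]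
    rw [integral_finsetSum _ fun g' _ => integrable_const_mul_character _ _]
    simp only [integral_const_mul, integral_character, add_neg_eq_zero, mul_ite, mul_one, mul_zero]
    rw [Finset.sum_ite_eq']
    split_ifs with hh
    · rfl
    · exact (hbA k h hh).symm
  have hGsq : ∀ k, ∫⁻ y, ‖G k y‖ₑ ^ 2 =
      ∑ h ∈ A, ‖(if h = k then 1 else 0) - c k h‖ₑ ^ 2 + (if k ∈ A then 0 else 1) := by
    intro k
    simp only [hGsum]
    rw [lintegral_enorm_trigPoly_sq]
    have hA : ∑ h ∈ A, ‖(if h = k then 1 else 0) - c k h‖ₑ ^ 2 = ∑ h ∈ A, ‖b k h‖ₑ ^ 2 :=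
      Finset.sum_congr rfl fun h hh => by simp [hb, hh]
    rw [hA]
    by_cases hk : k ∈ A
    · simp [Finset.insert_eq_of_mem hk, hk]
    · rw [Finset.sum_insert hk, add_comm]
      simp [hb, hk]
  set Z : (Fin d → ℤ) × A' → Cube d → ℂ := fun p y =>
    b p.1 p.2 - G p.1 y * character (-(p.2 : Fin d → ℤ)) y with hZ
  have hXc : ∀ p : (Fin d → ℤ) × A', Continuous fun y =>
      G p.1 y * character (-(p.2 : Fin d → ℤ)) y :=
    fun p => (hGc p.1).mul (continuous_character _)
  have hZc : ∀ p, Continuous (Z p) := fun p => continuous_const.sub (hXc p)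
  have hZ0 : ∀ p, ∫ y, Z p y = 0 := by
    intro p
    simp only [hZ]
    rw [integral_sub (integrable_const _) (integrable_of_continuous (hXc p)), hint]
    simp
  have hZsq : ∀ p, ∫⁻ y, ‖Z p y‖ₑ ^ 2 ≤ ∫⁻ y, ‖G p.1 y‖ₑ ^ 2 := by
    intro p
    have h1 := lintegral_enorm_const_add_sq (f := fun y => - Z p y) (hZc p).neg
      (by rw [integral_neg, hZ0, neg_zero]) (b p.1 p.2)
    have h2 : ∀ y, ‖b p.1 p.2 + -Z p y‖ₑ ^ 2 = ‖G p.1 y‖ₑ ^ 2 := by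
      intro y
      simp only [hZ, neg_sub, add_sub_cancel, enorm_mul, enorm_character, mul_one]
    simp only [h2, enorm_neg] at h1
    rw [h1]
    exact le_add_self
  have hV : ∑' p : (Fin d → ℤ) × A', ENNReal.ofReal (decayProd α γ p.1) * ∫⁻ y, ‖Z p y‖ₑ ^ 2 ≤
      A'.card * (sampleError α γ A x a + tail α γ A) := by
    refine (ENNReal.tsum_le_tsum fun p => mul_le_mul_right (hZsq p) _).trans ?_
    rw [ENNReal.tsum_prod (f := fun (k : Fin d → ℤ) (_ : A') =>
      ENNReal.ofReal (decayProd α γ k) * ∫⁻ y, ‖G k y‖ₑ ^ 2)]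
    unfold sampleError tail
    rw [← ENNReal.tsum_add, ← ENNReal.tsum_mul_left]
    refine ENNReal.tsum_le_tsum fun k => ?_
    rw [tsum_fintype, Finset.sum_const, Finset.card_univ, Fintype.card_coe, nsmul_eq_mul, hGsq,
      mul_add, mul_ite, mul_one, mul_zero]
  obtain ⟨y, hy⟩ := exists_sample _ Z hZc hZ0 hV n
  have hn0 : (n : ℂ) ≠ 0 := by exact_mod_cast (by omega : n ≠ 0)
  refine ⟨Fin.append x y, fun h => Fin.append
    (fun i => (if h ∈ A then a h i else 0) -
      (n : ℂ)⁻¹ * ∑ l, ∑ g ∈ A, a g i * character g (y l) * character (-h) (y l))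
    (fun l => (n : ℂ)⁻¹ * character (-h) (y l)), ?_⟩
  have hE : ∀ k h : Fin d → ℤ, (n : ℂ) * ((if h = k then 1 else 0) -
      ∑ i, Fin.append
    (fun i => (if h ∈ A then a h i else 0) -
      (n : ℂ)⁻¹ * ∑ l, ∑ g ∈ A, a g i * character g (y l) * character (-h) (y l))
    (fun l => (n : ℂ)⁻¹ * character (-h) (y l)) i * character k (Fin.append x y i)) =
      ∑ l, (b k h - G k (y l) * character (-h) (y l)) := by
    intro k h
    simp only [Fin.sum_univ_add, Fin.append_left, Fin.append_right, hb, hG,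
      Finset.sum_sub_distrib, sub_mul, Finset.sum_const, Finset.card_univ, Fintype.card_fin,
      nsmul_eq_mul]
    have e1 : ∑ i, (if h ∈ A then a h i else 0) * character k (x i) =
        if h ∈ A then c k h else 0 := by
      split_ifs <;> simp [hc]
    have e2 : ∑ i, (n : ℂ)⁻¹ * (∑ l, ∑ g ∈ A, a g i * character g (y l) * character (-h) (y l)) *
        character k (x i) =
        (n : ℂ)⁻¹ * ∑ l, (∑ g ∈ A, c k g * character g (y l)) * character (-h) (y l) := by
      simp only [hc, Finset.mul_sum, Finset.sum_mul]
      rw [Finset.sum_comm]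
      refine Finset.sum_congr rfl fun l _ => ?_
      rw [Finset.sum_comm]
      refine Finset.sum_congr rfl fun g _ => Finset.sum_congr rfl fun i _ => ?_
      ring
    have e3 : ∑ l, (n : ℂ)⁻¹ * character (-h) (y l) * character k (y l) =
        (n : ℂ)⁻¹ * ∑ l, character k (y l) * character (-h) (y l) := by
      rw [Finset.mul_sum]
      exact Finset.sum_congr rfl fun l _ => by ring
    rw [e1, e2, e3]
    field_simp
    ring
  have hS : (n : ℝ≥0∞) ^ 2 * sampleError α γ A' (Fin.append x y) (fun h => Fin.append
    (fun i => (if h ∈ A then a h i else 0) -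
      (n : ℂ)⁻¹ * ∑ l, ∑ g ∈ A, a g i * character g (y l) * character (-h) (y l))
    (fun l => (n : ℂ)⁻¹ * character (-h) (y l))) =
      ∑' p : (Fin d → ℤ) × A', ENNReal.ofReal (decayProd α γ p.1) *
        ‖∑ l, Z p (y l)‖ₑ ^ 2 := by
    rw [ENNReal.tsum_prod (f := fun (k : Fin d → ℤ) (h : A') =>
      ENNReal.ofReal (decayProd α γ k) * ‖∑ l, Z (k, h) (y l)‖ₑ ^ 2)]
    unfold sampleError
    rw [← ENNReal.tsum_mul_left]
    refine tsum_congr fun k => ?_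
    rw [tsum_fintype, ← Finset.mul_sum, ← Finset.sum_coe_sort A', mul_left_comm, Finset.mul_sum]
    congr 1
    refine Finset.sum_congr rfl fun h _ => ?_
    rw [show ∑ l, Z (k, h) (y l) = _ from (hE k h).symm, enorm_mul, mul_pow]
    congr 2
    rw [← ofReal_norm]; simp
  rw [← hS, sq, mul_assoc] at hy
  exact (ENNReal.mul_le_mul_iff_right (by exact_mod_cast (by omega : n ≠ 0)) (by simp)).mp hy

theorem enorm_sum_sq_le {ι : Type*} (A : Finset ι) (u : ι → ℂ) :
    ‖∑ h ∈ A, u h‖ₑ ^ 2 ≤ A.card * ∑ h ∈ A, ‖u h‖ₑ ^ 2 := by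
  refine (pow_le_pow_left' (enorm_sum_le A u) 2).trans ?_
  have h := tsum_mul_sq_le (fun _ : A => 1) (fun h : A => ‖u h‖ₑ)
  simp only [tsum_fintype, one_mul, one_pow, Finset.sum_const, Finset.card_univ, Fintype.card_coe,
    nsmul_eq_mul, mul_one, Finset.sum_coe_sort A (fun h => ‖u h‖ₑ),
    Finset.sum_coe_sort A (fun h => ‖u h‖ₑ ^ 2)] at h
  exact h

theorem enorm_add_sq_le (u v : ℂ) : ‖u + v‖ₑ ^ 2 ≤ 2 * (‖u‖ₑ ^ 2 + ‖v‖ₑ ^ 2) := by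
  refine (pow_le_pow_left' (enorm_add_le u v) 2).trans ?_
  have h := ENNReal.rpow_add_le_mul_rpow_add_rpow ‖u‖ₑ ‖v‖ₑ one_le_two
  norm_num at h
  exact h

theorem minimalError_std_sq_le (hγ : ∀ j, 0 < γ j) (A : Finset (Fin d → ℤ)) {N : ℕ}
    (x : Fin N → Cube d) (a : (Fin d → ℤ) → Fin N → ℂ) {n : ℕ} (hN : N ≤ n) :
    minimalError α γ d .std n ^ 2 ≤
      2 * (tail α γ A + A.card * sampleError α γ A x a) := by
  classical
  refine minimalError_sq_le_of_algorithm (L := .std) hγ hN (fun i => evalFunctional α γ (x i))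
    (fun i y => ∑ h ∈ A, a h i * character h y) (fun i => ⟨x i, fun _ => rfl⟩)
    (fun i => continuous_finsetSum _ fun h _ => continuous_const.mul (continuous_character h))
    fun f hf y => ?_
  have h1 : HasSum (fun k => fourierCoef (f : Cube d → ℂ) k *
      (character k y - ∑ i, character k (x i) * ∑ h ∈ A, a h i * character h y))
      ((f : Cube d → ℂ) y - ∑ i, evalFunctional α γ (x i) f *
        ∑ h ∈ A, a h i * character h y) := by
    have h2 := (f.2.2.2 y).sub (hasSum_sum (s := Finset.univ) fun i _ =>
      (f.2.2.2 (x i)).mul_right (∑ h ∈ A, a h i * character h y))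
    simp only [mul_sub, Finset.mul_sum (s := Finset.univ), ← mul_assoc] at h2 ⊢
    exact h2
  refine (enorm_sq_le_of_hasSum hγ f h1).trans ((ofReal_korobovNorm_sq_mul_le hf _).trans ?_)
  unfold tail sampleError
  rw [← ENNReal.tsum_mul_left, ← ENNReal.tsum_add, ← ENNReal.tsum_mul_left]
  refine ENNReal.tsum_le_tsum fun k => ?_
  have h3 : character k y - ∑ i, character k (x i) * ∑ h ∈ A, a h i * character h y =
      (if k ∈ A then 0 else character k y) +
        ∑ h ∈ A, ((if h = k then 1 else 0) - ∑ i, a h i * character k (x i)) * character h y := by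
    simp only [sub_mul, Finset.sum_sub_distrib, ite_mul, one_mul, zero_mul]
    rw [Finset.sum_ite_eq']
    have h4 : ∑ i, character k (x i) * ∑ h ∈ A, a h i * character h y =
        ∑ h ∈ A, (∑ i, a h i * character k (x i)) * character h y := by
      simp only [Finset.mul_sum, Finset.sum_mul]
      rw [Finset.sum_comm]
      exact Finset.sum_congr rfl fun _ _ => Finset.sum_congr rfl fun _ _ => by ring
    rw [h4]
    split_ifs <;> ring
  have h5 : ‖∑ h ∈ A, ((if h = k then 1 else 0) - ∑ i, a h i * character k (x i)) *
      character h y‖ₑ ^ 2 ≤ A.card * ∑ h ∈ A, ‖(if h = k then 1 else 0) -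
        ∑ i, a h i * character k (x i)‖ₑ ^ 2 := by
    simpa only [enorm_mul, enorm_character, mul_one] using enorm_sum_sq_le A
      (fun h => ((if h = k then 1 else 0) - ∑ i, a h i * character k (x i)) * character h y)
  have h6 : ENNReal.ofReal (decayProd α γ k) * ‖(if k ∈ A then 0 else character k y)‖ₑ ^ 2 =
      if k ∈ A then 0 else ENNReal.ofReal (decayProd α γ k) := by
    split_ifs <;> simp [enorm_character]
  rw [h3]
  refine (mul_le_mul_right ((enorm_add_sq_le _ _).trans
    (mul_le_mul_right (add_le_add_right h5 _) _)) _).trans (le_of_eq ?_)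
  rw [← h6]
  ring

theorem exists_sampling_stage {τ M : ℝ} (hα : 0 < α) (hγ : ∀ j, 0 < γ j) (hγ1 : ∀ j, γ j ≤ 1)
    (hτ : 0 < τ) (hτ1 : τ < 1) (hM : 1 ≤ M)
    (hsum : ∑' h : Fin d → ℤ, ENNReal.ofReal (decayProd α γ h ^ τ) ≤ ENNReal.ofReal M)
    {K : ℕ} (hK : 2 * (2 : ℝ) ^ ((1 - τ) / τ) ≤ K) (j : ℕ) :
    ∃ (A : Finset (Fin d → ℤ)) (N : ℕ) (x : Fin N → Cube d) (a : (Fin d → ℤ) → Fin N → ℂ),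
      N ≤ K * 2 ^ (j + 1) ∧ sampleError α γ A x a + tail α γ A ≤
        ENNReal.ofReal (2 * (M ^ (1 / τ) * ((2 : ℝ) ^ j) ^ (-((1 - τ) / τ)))) := by
  have hK0 : (0 : ℝ) < K := lt_of_lt_of_le (by positivity) hK
  have hK1 : 1 ≤ K := by exact_mod_cast hK0
  induction j with
  | zero =>
    refine ⟨∅, 0, Fin.elim0, fun _ => Fin.elim0, Nat.zero_le _, ?_⟩
    have h1 : M ≤ M ^ (1 / τ) := Real.self_le_rpow_of_one_le hM (by
      rw [le_div_iff₀ hτ]; linarith)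
    have h2 := (tsum_decayProd_le hα hγ hγ1 hτ1.le).trans hsum
    simp only [sampleError, tail, Finset.sum_empty, mul_zero, tsum_zero, zero_add,
      Finset.notMem_empty, if_false, pow_zero, Real.one_rpow, mul_one]
    exact h2.trans (ENNReal.ofReal_le_ofReal (by linarith))
  | succ j ih =>
    obtain ⟨A, N, x, a, hN, hE⟩ := ih
    obtain ⟨A', hA', hT⟩ := exists_truncation hγ hτ hτ1 hM hsum
      (m := 2 ^ (j + 1)) Nat.one_le_two_pow
    obtain ⟨x', a', h⟩ := exists_refinement A A' x a (n := K * 2 ^ (j + 1))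
      (Nat.mul_pos hK1 (by positivity))
    refine ⟨A', N + K * 2 ^ (j + 1), x', a', by rw [pow_succ 2 (j + 1)]; linarith, ?_⟩
    set β : ℝ := M ^ (1 / τ) * ((2 : ℝ) ^ (j + 1)) ^ (-((1 - τ) / τ)) with hβ
    have hβ0 : 0 ≤ β := by positivity
    have hβj : 2 * (M ^ (1 / τ) * ((2 : ℝ) ^ j) ^ (-((1 - τ) / τ))) ≤ K * β := by
      have : ((2 : ℝ) ^ j) ^ (-((1 - τ) / τ)) =
          2 ^ ((1 - τ) / τ) * ((2 : ℝ) ^ (j + 1)) ^ (-((1 - τ) / τ)) := by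
        rw [pow_succ, Real.mul_rpow (by positivity) (by norm_num), mul_left_comm,
          ← Real.rpow_add two_pos]
        simp
      rw [this, hβ]
      calc _ = (2 * (2 : ℝ) ^ ((1 - τ) / τ)) *
            (M ^ (1 / τ) * ((2 : ℝ) ^ (j + 1)) ^ (-((1 - τ) / τ))) := by ring
        _ ≤ _ := mul_le_mul_of_nonneg_right hK hβ0
    have hpow0 : ((2 : ℝ≥0∞) ^ (j + 1)) ≠ 0 := by positivity
    have hpowt : ((2 : ℝ≥0∞) ^ (j + 1)) ≠ ⊤ := by simp
    have h2 : (2 : ℝ≥0∞) ^ (j + 1) * (K * sampleError α γ A' x' a') ≤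
        2 ^ (j + 1) * (K * ENNReal.ofReal β) := by
      calc _ = ((K * 2 ^ (j + 1) : ℕ) : ℝ≥0∞) * sampleError α γ A' x' a' := by push_cast; ring
        _ ≤ _ := h
        _ ≤ 2 ^ (j + 1) * ENNReal.ofReal
            (2 * (M ^ (1 / τ) * ((2 : ℝ) ^ j) ^ (-((1 - τ) / τ)))) := by
            refine mul_le_mul' (by exact_mod_cast hA') hE
        _ ≤ 2 ^ (j + 1) * ENNReal.ofReal (K * β) := by gcongr
        _ = _ := by rw [ENNReal.ofReal_mul hK0.le, ENNReal.ofReal_natCast]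
    have h3 : sampleError α γ A' x' a' ≤ ENNReal.ofReal β :=
      (ENNReal.mul_le_mul_iff_right (by exact_mod_cast hK0.ne') (by simp)).mp
        ((ENNReal.mul_le_mul_iff_right hpow0 hpowt).mp h2)
    rw [two_mul, ENNReal.ofReal_add hβ0 hβ0]
    refine add_le_add h3 (hT.trans (le_of_eq ?_))
    rw [hβ]; push_cast; rfl

theorem minimalError_std_dyadic_sq_le {τ M : ℝ} (hα : 0 < α) (hγ : ∀ j, 0 < γ j)
    (hγ1 : ∀ j, γ j ≤ 1) (hτ : 0 < τ) (hτ1 : τ < 1) (hM : 1 ≤ M)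
    (hsum : ∑' h : Fin d → ℤ, ENNReal.ofReal (decayProd α γ h ^ τ) ≤ ENNReal.ofReal M)
    {K : ℕ} (hK : 2 * (2 : ℝ) ^ ((1 - τ) / τ) ≤ K) (J : ℕ) {n : ℕ} (hn : 3 * K * 2 ^ J ≤ n) :
    minimalError α γ d .std n ^ 2 ≤
      ENNReal.ofReal (M ^ (1 / τ) * ((2 * 2 ^ ((1 - τ) / τ) + 4) *
        ((2 : ℝ) ^ J) ^ (-((1 - τ) / τ / (1 + τ))))) := by
  have hK0 : (0 : ℝ) < K := lt_of_lt_of_le (by positivity) hK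
  have hK1 : 1 ≤ K := by exact_mod_cast hK0
  have hM0 : 0 < M := by linarith
  set q : ℝ := (1 - τ) / τ with hq
  have hq0 : 0 < q := div_pos (by linarith) hτ
  set X : ℝ := (2 : ℝ) ^ J with hX
  have hX1 : 1 ≤ X := one_le_pow₀ one_le_two
  have hX0 : 0 < X := by linarith
  set Y : ℝ := X ^ (1 / (1 + τ)) with hY
  have hY1 : 1 ≤ Y := Real.one_le_rpow hX1 (by positivity)
  set m : ℕ := ⌊Y⌋₊ with hm
  have hm1 : 1 ≤ m := Nat.le_floor (by simpa using hY1)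
  have hmY : (m : ℝ) ≤ Y := Nat.floor_le (by linarith)
  have hmY2 : Y / 2 ≤ m := by
    have := Nat.lt_floor_add_one Y
    have h1 : (1 : ℝ) ≤ m := by exact_mod_cast hm1
    rw [← hm] at this
    linarith
  obtain ⟨A, N, x, a, hN, hE⟩ := exists_sampling_stage hα hγ hγ1 hτ hτ1 hM hsum hK J
  obtain ⟨A', hA', hT⟩ := exists_truncation hγ hτ hτ1 hM hsum hm1
  obtain ⟨x', a', h⟩ := exists_refinement A A' x a (n := 2 ^ J) Nat.one_le_two_pow
  rw [← hq] at hE hT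
  have hNn : N + 2 ^ J ≤ n := by
    refine le_trans ?_ hn
    have : 1 * 2 ^ J ≤ K * 2 ^ J := Nat.mul_le_mul_right _ hK1
    rw [pow_succ] at hN
    nlinarith
  refine (minimalError_std_sq_le hγ A' x' a' hNn).trans ?_
  have hs : sampleError α γ A' x' a' ≤ ENNReal.ofReal (m * (2 * (M ^ (1 / τ) * X ^ (-q))) / X) := by
    rw [ENNReal.ofReal_div_of_pos hX0, ENNReal.le_div_iff_mul_le
      (Or.inl (by simpa using hX0)) (Or.inl ENNReal.ofReal_ne_top), mul_comm,
      ENNReal.ofReal_mul (by positivity), ENNReal.ofReal_natCast]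
    have hXe : ENNReal.ofReal X = ((2 ^ J : ℕ) : ℝ≥0∞) := by
      rw [← ENNReal.ofReal_natCast, hX]; push_cast; rfl
    rw [hXe]
    exact h.trans (mul_le_mul' (by exact_mod_cast hA') hE)
  have hcard : ((A'.card : ℕ) : ℝ≥0∞) ≤ ENNReal.ofReal m := by
    rw [ENNReal.ofReal_natCast]; exact_mod_cast hA'
  calc 2 * (tail α γ A' + A'.card * sampleError α γ A' x' a')
      ≤ ENNReal.ofReal 2 * (ENNReal.ofReal (M ^ (1 / τ) * (m : ℝ) ^ (-q)) +
          ENNReal.ofReal m * ENNReal.ofReal (m * (2 * (M ^ (1 / τ) * X ^ (-q))) / X)) := by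
        rw [ENNReal.ofReal_ofNat]
        gcongr
        exact hT
    _ = ENNReal.ofReal (2 * (M ^ (1 / τ) * (m : ℝ) ^ (-q) +
          m * (m * (2 * (M ^ (1 / τ) * X ^ (-q))) / X))) := by
        rw [← ENNReal.ofReal_mul (by positivity), ← ENNReal.ofReal_add (by positivity)
          (by positivity), ← ENNReal.ofReal_mul (by positivity)]
    _ ≤ _ := by
        refine ENNReal.ofReal_le_ofReal ?_
        have h1 : (m : ℝ) ^ (-q) ≤ 2 ^ q * X ^ (-(q / (1 + τ))) := by
          calc (m : ℝ) ^ (-q) ≤ (Y / 2) ^ (-q) :=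
                Real.rpow_le_rpow_of_nonpos (by positivity) hmY2 (by linarith)
            _ = _ := by
                rw [Real.div_rpow (by positivity) (by norm_num), Real.rpow_neg two_pos.le, div_inv_eq_mul,
                  hY, ← Real.rpow_mul hX0.le, mul_comm]
                congr 2; ring
        have h2 : (m : ℝ) * m * X ^ (-q) / X ≤ X ^ (-(q / (1 + τ))) := by
          calc (m : ℝ) * m * X ^ (-q) / X ≤ Y * Y * X ^ (-q) / X := by gcongr
            _ = _ := by
                rw [hY, div_eq_mul_inv, ← Real.rpow_neg_one X, ← Real.rpow_add hX0,
                  ← Real.rpow_add hX0, ← Real.rpow_add hX0]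
                congr 1
                rw [hq]; field_simp; ring
        calc 2 * (M ^ (1 / τ) * (m : ℝ) ^ (-q) + m * (m * (2 * (M ^ (1 / τ) * X ^ (-q))) / X))
            = M ^ (1 / τ) * (2 * (m : ℝ) ^ (-q) + 4 * ((m : ℝ) * m * X ^ (-q) / X)) := by ring
          _ ≤ M ^ (1 / τ) * (2 * (2 ^ q * X ^ (-(q / (1 + τ)))) + 4 * X ^ (-(q / (1 + τ)))) := by
            gcongr
          _ = _ := by ring

theorem exists_minimalError_std_le {τ : ℝ} (hτ : 0 < τ) (hτ1 : τ < 1) :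
    ∃ C : ℝ, 1 ≤ C ∧ ∀ (α : ℝ) (γ : ℕ → ℝ) (d : ℕ) (M : ℝ), 0 < α → (∀ j, 0 < γ j) →
      (∀ j, γ j ≤ 1) → 1 ≤ M →
      ∑' h : Fin d → ℤ, ENNReal.ofReal (decayProd α γ h ^ τ) ≤ ENNReal.ofReal M →
      ∀ n : ℕ, 1 ≤ n → minimalError α γ d .std n ≤
        ENNReal.ofReal (C * M ^ (1 / (2 * τ)) * (n : ℝ) ^ (-((1 - τ) / (2 * τ * (1 + τ))))) := by
  obtain ⟨K, hK⟩ := exists_nat_ge (2 * (2 : ℝ) ^ ((1 - τ) / τ))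
  have hK0 : (0 : ℝ) < K := lt_of_lt_of_le (by positivity) hK
  have hK1 : 1 ≤ K := by exact_mod_cast hK0
  set q : ℝ := (1 - τ) / τ with hq
  have hq0 : 0 < q := div_pos (by linarith) hτ
  set r : ℝ := q / (1 + τ) with hr
  have hr0 : 0 < r := by positivity
  set D : ℝ := (2 * 2 ^ q + 4) * (6 * K) ^ r with hD
  have hD1 : 1 ≤ D := by
    have h1 : (1 : ℝ) ≤ 2 ^ q := Real.one_le_rpow one_le_two hq0.le
    have h2 : (1 : ℝ) ≤ (6 * K) ^ r := by
      refine Real.one_le_rpow ?_ hr0.le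
      have : (1 : ℝ) ≤ K := by exact_mod_cast hK1
      linarith
    nlinarith
  refine ⟨Real.sqrt D, Real.one_le_sqrt.mpr hD1, ?_⟩
  intro α γ d M hα hγ hγ1 hM hsum n hn
  have hn0 : (0 : ℝ) < n := by exact_mod_cast hn
  have hM0 : 0 < M := by linarith
  have key : minimalError α γ d .std n ^ 2 ≤ ENNReal.ofReal (M ^ (1 / τ) * (D * (n : ℝ) ^ (-r))) := by
    rcases lt_or_ge n (3 * K) with hlt | hge
    · refine (minimalError_sq_le_tsum hγ n).trans (((tsum_decayProd_le hα hγ hγ1 hτ1.le).trans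
        hsum).trans (ENNReal.ofReal_le_ofReal ?_))
      have h1 : M ≤ M ^ (1 / τ) := Real.self_le_rpow_of_one_le hM (by
        rw [le_div_iff₀ hτ]; linarith)
      have h2 : 1 ≤ D * (n : ℝ) ^ (-r) := by
        have h3 : (n : ℝ) ^ r ≤ (6 * K) ^ r := by
          refine Real.rpow_le_rpow hn0.le ?_ hr0.le
          have : (n : ℝ) < 3 * K := by exact_mod_cast hlt
          linarith
        have h4 : (6 * K : ℝ) ^ r ≤ D := by
          have h1 : (0 : ℝ) < 2 ^ q := by positivity
          have h2 : (0 : ℝ) < (6 * K) ^ r := by positivity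
          rw [hD]
          nlinarith
        rw [Real.rpow_neg hn0.le, ← div_eq_mul_inv, one_le_div (by positivity)]
        linarith
      calc M ≤ M ^ (1 / τ) * 1 := by linarith
        _ ≤ _ := by gcongr
    · set J := Nat.log 2 (n / (3 * K)) with hJ
      have hdiv : 1 ≤ n / (3 * K) := (Nat.one_le_div_iff (by omega)).mpr hge
      have h1 : 3 * K * 2 ^ J ≤ n := by
        have := Nat.pow_log_le_self 2 (x := n / (3 * K)) (by omega)
        calc 3 * K * 2 ^ J ≤ 3 * K * (n / (3 * K)) := Nat.mul_le_mul_left _ this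
          _ ≤ n := Nat.mul_div_le _ _
      have h2 : n ≤ 6 * K * 2 ^ J := by
        have h3 : n / (3 * K) < 2 ^ (J + 1) := Nat.lt_pow_succ_log_self one_lt_two _
        rw [Nat.div_lt_iff_lt_mul (by omega), pow_succ] at h3
        linarith
      refine (minimalError_std_dyadic_sq_le hα hγ hγ1 hτ hτ1 hM hsum hK J h1).trans
        (ENNReal.ofReal_le_ofReal ?_)
      rw [← hq, ← hr, hD, mul_assoc (2 * (2 : ℝ) ^ q + 4)]
      gcongr
      have h4 : (n : ℝ) / (6 * K) ≤ 2 ^ J := by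
        rw [div_le_iff₀ (by positivity)]
        calc (n : ℝ) ≤ ((6 * K * 2 ^ J : ℕ) : ℝ) := by exact_mod_cast h2
          _ = _ := by push_cast; ring
      calc ((2 : ℝ) ^ J) ^ (-r) ≤ ((n : ℝ) / (6 * K)) ^ (-r) :=
            Real.rpow_le_rpow_of_nonpos (by positivity) h4 (by linarith)
        _ = _ := by
            rw [Real.div_rpow hn0.le (by positivity), Real.rpow_neg (by positivity : (0:ℝ) ≤ 6 * K),
              div_inv_eq_mul, mul_comm]
  refine (ENNReal.pow_le_pow_left_iff two_ne_zero).mp (key.trans (le_of_eq ?_))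
  rw [← ENNReal.ofReal_pow (by positivity), mul_pow, mul_pow, Real.sq_sqrt (by linarith),
    ← Real.rpow_natCast (M ^ _), ← Real.rpow_natCast ((n : ℝ) ^ _),
    ← Real.rpow_mul (by positivity), ← Real.rpow_mul (by positivity)]
  have e1 : 1 / (2 * τ) * ((2 : ℕ) : ℝ) = 1 / τ := by push_cast; field_simp
  have e2 : -((1 - τ) / (2 * τ * (1 + τ))) * ((2 : ℕ) : ℝ) = -r := by
    rw [hr, hq]; push_cast; field_simp
  rw [e1, e2]
  congr 1; ring

/-- An `n`-dimensional subspace approximates an orthonormal family badly. -/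
theorem sum_sub_finrank_le {E ι : Type*} [NormedAddCommGroup E] [InnerProductSpace ℂ E]
    {v : ι → E} (hv : Orthonormal ℂ v) (W : Submodule ℂ E) [FiniteDimensional ℂ W] (w : ι → E)
    (hw : ∀ i, w i ∈ W) (F : Finset ι) (s : ι → ℝ) (hs0 : ∀ i, 0 ≤ s i) (hs1 : ∀ i, s i ≤ 1) :
    ∑ i ∈ F, s i - Module.finrank ℂ W ≤ ∑ i ∈ F, s i * ‖v i - w i‖ ^ 2 := by
  set b := stdOrthonormalBasis ℂ W
  have h1 : ∀ i, 1 - ∑ j, ‖inner ℂ (b j : E) (v i)‖ ^ 2 ≤ ‖v i - w i‖ ^ 2 := by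
    intro i
    have e1 := W.norm_sq_eq_add_norm_sq_projection (v i)
    have e2 := W.norm_sq_eq_add_norm_sq_projection (v i - w i)
    have e3 : Wᗮ.orthogonalProjectionOnto (v i - w i) = Wᗮ.orthogonalProjectionOnto (v i) := by
      rw [map_sub, sub_eq_self]
      exact Submodule.orthogonalProjectionOnto_orthogonal_apply_eq_zero (hw i)
    have e4 : ∑ j, ‖inner ℂ (b j : E) (v i)‖ ^ 2 = ‖W.orthogonalProjectionOnto (v i)‖ ^ 2 := by
      rw [← b.sum_sq_norm_inner_right]
      refine Finset.sum_congr rfl fun j _ => ?_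
      rw [Submodule.inner_orthogonalProjectionOnto_eq_of_mem_left]
    rw [e3] at e2
    rw [hv.1 i] at e1
    rw [e4]
    nlinarith [sq_nonneg ‖W.orthogonalProjectionOnto (v i - w i)‖]
  have h2 : ∑ i ∈ F, ∑ j, ‖inner ℂ (b j : E) (v i)‖ ^ 2 ≤ Module.finrank ℂ W := by
    rw [Finset.sum_comm]
    calc ∑ j, ∑ i ∈ F, ‖inner ℂ (b j : E) (v i)‖ ^ 2 ≤ ∑ j : Fin (Module.finrank ℂ W), (1 : ℝ) := by
          refine Finset.sum_le_sum fun j _ => ?_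
          have := hv.sum_inner_products_le (b j : E) (s := F)
          have hb : ‖(b j : E)‖ = 1 := b.orthonormal.1 j
          rw [hb, one_pow] at this
          refine le_trans (le_of_eq (Finset.sum_congr rfl fun i _ => ?_)) this
          rw [norm_inner_symm]
      _ = _ := by simp
  have h3 : ∑ i ∈ F, s i * (1 - ∑ j, ‖inner ℂ (b j : E) (v i)‖ ^ 2) ≤
      ∑ i ∈ F, s i * ‖v i - w i‖ ^ 2 :=
    Finset.sum_le_sum fun i _ => mul_le_mul_of_nonneg_left (h1 i) (hs0 i)
  have h4 : ∑ i ∈ F, s i * ∑ j, ‖inner ℂ (b j : E) (v i)‖ ^ 2 ≤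
      ∑ i ∈ F, ∑ j, ‖inner ℂ (b j : E) (v i)‖ ^ 2 :=
    Finset.sum_le_sum fun i _ => mul_le_of_le_one_left
      (Finset.sum_nonneg fun j _ => sq_nonneg _) (hs1 i)
  simp only [mul_sub, mul_one, Finset.sum_sub_distrib] at h3
  linarith

theorem memLp_character (h : Fin d → ℤ) : MemLp (character h) 2 volume :=
  MemLp.of_bound (continuous_character h).aestronglyMeasurable 1
    (Eventually.of_forall fun x => (norm_character h x).le)

theorem orthonormal_character :
    Orthonormal ℂ fun h : Fin d → ℤ => (memLp_character h).toLp (character h) := by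
  classical
  rw [orthonormal_iff_ite]
  intro h k
  rw [L2.inner_def]
  have : (fun a => inner ℂ ((memLp_character h).toLp (character h) a)
      ((memLp_character k).toLp (character k) a)) =ᵐ[volume] character (k + -h) := by
    filter_upwards [(memLp_character h).coeFn_toLp, (memLp_character k).coeFn_toLp] with a h1 h2
    rw [h1, h2, RCLike.inner_apply, conj_character, character_add]
  rw [integral_congr_ae this, integral_character]
  simp only [add_neg_eq_zero, eq_comm]

theorem norm_sq_toLp_eq {f : Cube d → ℂ} (hf : MemLp f 2 volume) :
    ‖hf.toLp f‖ ^ 2 = ∫ x, ‖f x‖ ^ 2 := by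
  have h1 : ((‖hf.toLp f‖ ^ 2 : ℝ) : ℂ) = ((∫ x, ‖f x‖ ^ 2 : ℝ) : ℂ) := by
    rw [Complex.ofReal_pow, ← Complex.coe_algebraMap, ← inner_self_eq_norm_sq_to_K (𝕜 := ℂ),
      L2.inner_def, Complex.coe_algebraMap, ← integral_complex_ofReal]
    refine integral_congr_ae ?_
    filter_upwards [hf.coeFn_toLp] with a ha
    rw [ha, inner_self_eq_norm_sq_to_K]
    simp
  exact_mod_cast h1

/-- The error of a linear algorithm for the character `e_h`. -/
def charError {n : ℕ} (T : Fin n → (Space α γ d →ₗ[ℂ] ℂ)) (g : Fin n → Cube d → ℂ)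
    (h : Fin d → ℤ) (x : Cube d) : ℂ :=
  character h x - ∑ i, T i (charElt α γ h) * g i x

theorem memLp_charError {n : ℕ} (T : Fin n → (Space α γ d →ₗ[ℂ] ℂ)) {g : Fin n → Cube d → ℂ}
    (hg : ∀ i, MemLp (g i) 2 volume) (h : Fin d → ℤ) : MemLp (charError T g h) 2 volume :=
  (memLp_character h).sub (memLp_finsetSum _ fun i _ => (hg i).const_mul _)

theorem sum_sub_card_le_sum_integral {n : ℕ} (T : Fin n → (Space α γ d →ₗ[ℂ] ℂ))
    {g : Fin n → Cube d → ℂ} (hg : ∀ i, MemLp (g i) 2 volume) (F : Finset (Fin d → ℤ))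
    (s : (Fin d → ℤ) → ℝ) (hs0 : ∀ i, 0 ≤ s i) (hs1 : ∀ i, s i ≤ 1) :
    ∑ h ∈ F, s h - n ≤ ∑ h ∈ F, s h * ∫ x, ‖charError T g h x‖ ^ 2 := by
  set W : Submodule ℂ (Lp ℂ 2 (volume : Measure (Cube d))) :=
    Submodule.span ℂ (Set.range fun i => (hg i).toLp (g i)) with hW
  have hfr : Module.finrank ℂ W ≤ n := by
    have := finrank_range_le_card (R := ℂ) fun i => (hg i).toLp (g i)
    rwa [Fintype.card_fin] at this
  have : FiniteDimensional ℂ W := FiniteDimensional.span_of_finite ℂ (Set.finite_range _)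
  have h1 := sum_sub_finrank_le (orthonormal_character (d := d)) W
    (fun h => ∑ i, T i (charElt α γ h) • (hg i).toLp (g i))
    (fun h => Submodule.sum_mem _ fun i _ => Submodule.smul_mem _ _
      (Submodule.subset_span ⟨i, rfl⟩)) F s hs0 hs1
  have h2 : ∀ h, ‖(memLp_character h).toLp (character h) -
      ∑ i, T i (charElt α γ h) • (hg i).toLp (g i)‖ ^ 2 = ∫ x, ‖charError T g h x‖ ^ 2 := by
    intro h
    rw [← norm_sq_toLp_eq (memLp_charError T hg h)]
    congr 2
    refine Lp.ext ?_
    refine (Lp.coeFn_sub _ _).trans ?_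
    refine EventuallyEq.trans ?_ (memLp_charError T hg h).coeFn_toLp.symm
    have h3 : ∀ i, ⇑(T i (charElt α γ h) • (hg i).toLp (g i)) =ᵐ[volume]
        fun x => T i (charElt α γ h) * g i x := by
      intro i
      filter_upwards [Lp.coeFn_smul (T i (charElt α γ h)) ((hg i).toLp (g i)),
        (hg i).coeFn_toLp] with x e1 e2
      rw [e1, Pi.smul_apply, e2, smul_eq_mul]
    filter_upwards [(memLp_character h).coeFn_toLp,
      Lp.coeFn_finsetSum Finset.univ (fun i => T i (charElt α γ h) • (hg i).toLp (g i)),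
      ae_all_iff.mpr h3] with x e1 e2 e3
    rw [Pi.sub_apply, e1, e2]
    simp only [Finset.sum_apply, e3, charError]
  simp only [h2] at h1
  have : (Module.finrank ℂ W : ℝ) ≤ n := by exact_mod_cast hfr
  linarith

theorem korobovNorm_sum_smul_charElt_sq (F : Finset (Fin d → ℤ)) (b : (Fin d → ℤ) → ℂ) :
    korobovNorm (∑ h ∈ F, b h • charElt α γ h : Space α γ d) =
      Real.sqrt (∑ h ∈ F, ‖b h‖ ^ 2 / decayProd α γ h) := by
  classical
  have h1 : ∀ k, fourierCoef ((∑ h ∈ F, b h • charElt α γ h : Space α γ d) : Cube d → ℂ) k =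
      if k ∈ F then b k else 0 := by
    intro k
    change fourierFunctional α γ k _ = _
    rw [map_sum]
    have : ∀ h, fourierFunctional α γ k (b h • charElt α γ h) = if k = h then b h else 0 := by
      intro h
      rw [map_smul]
      change b h • fourierCoef (character h) k = _
      rw [fourierCoef_character]; simp
    simp [this]
  unfold korobovNorm
  simp only [h1]
  rw [tsum_eq_sum (s := F) fun k hk => by simp [hk]]
  congr 1
  exact Finset.sum_congr rfl fun k hk => by simp [hk]

theorem sum_decayProd_mul_integral_le (hγ : ∀ j, 0 < γ j) {n : ℕ}
    (T : Fin n → (Space α γ d →ₗ[ℂ] ℂ)) {g : Fin n → Cube d → ℂ}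
    (hg : ∀ i, MemLp (g i) 2 volume) {B : ℝ} (hB0 : 0 ≤ B)
    (hB : worstCaseError T g ≤ ENNReal.ofReal B) (F : Finset (Fin d → ℤ)) :
    ∑ h ∈ F, decayProd α γ h * ∫ x, ‖charError T g h x‖ ^ 2 ≤ B ^ 2 := by
  classical
  set z : (Fin d → ℤ) → Cube d → ℂ := fun h x =>
    (Real.sqrt (decayProd α γ h) : ℂ) * charError T g h x with hz
  have hρ : ∀ h : Fin d → ℤ, 0 < decayProd α γ h := fun h => decayProd_pos hγ h
  have hfix : ∀ a : (Fin d → ℤ) → ℂ, ∀ᵐ x, ‖∑ h ∈ F, a h * z h x‖ ^ 2 ≤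
      B ^ 2 * ∑ h ∈ F, ‖a h‖ ^ 2 := by
    intro a
    have hs0 : 0 ≤ ∑ h ∈ F, ‖a h‖ ^ 2 := Finset.sum_nonneg fun h _ => sq_nonneg _
    rcases hs0.eq_or_lt with h0 | hpos
    · refine Eventually.of_forall fun x => ?_
      have h1 := (Finset.sum_eq_zero_iff_of_nonneg fun h _ => sq_nonneg ‖a h‖).mp h0.symm
      have : ∑ h ∈ F, a h * z h x = 0 := Finset.sum_eq_zero fun h hh => by
        have := h1 h hh
        simp only [ne_eq, OfNat.ofNat_ne_zero, not_false_eq_true, pow_eq_zero_iff,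
          norm_eq_zero] at this
        simp [this]
      rw [this, ← h0]; simp
    · set s := Real.sqrt (∑ h ∈ F, ‖a h‖ ^ 2) with hs
      have hspos : 0 < s := Real.sqrt_pos.mpr hpos
      have hs2 : s ^ 2 = ∑ h ∈ F, ‖a h‖ ^ 2 := Real.sq_sqrt hs0
      set b : (Fin d → ℤ) → ℂ := fun h => (s : ℂ)⁻¹ * a h * (Real.sqrt (decayProd α γ h) : ℂ)
      set f : Space α γ d := ∑ h ∈ F, b h • charElt α γ h with hf
      have hbn : ∀ h, ‖b h‖ ^ 2 / decayProd α γ h = (s ^ 2)⁻¹ * ‖a h‖ ^ 2 := by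
        intro h
        simp only [b, norm_mul, norm_inv, Complex.norm_real, Real.norm_eq_abs, mul_pow, sq_abs,
          inv_pow, Real.sq_sqrt (hρ h).le]
        field_simp [(hρ h).ne']
      have hfn : korobovNorm f ≤ 1 := by
        rw [hf, korobovNorm_sum_smul_charElt_sq]
        simp only [hbn]
        rw [← Finset.mul_sum, ← hs2, inv_mul_cancel₀ (by positivity), Real.sqrt_one]
      have h1 : eLpNorm (fun x => (f : Cube d → ℂ) x - ∑ i, T i f * g i x) ∞ volume ≤
          ENNReal.ofReal B := le_trans (le_iSup₂_of_le f hfn le_rfl) hB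
      rw [eLpNorm_exponent_top] at h1
      filter_upwards [ae_le_eLpNormEssSup
        (f := fun x => (f : Cube d → ℂ) x - ∑ i, T i f * g i x) (μ := volume)] with x hx
      have h2 := hx.trans h1
      have h3 : (f : Cube d → ℂ) x - ∑ i, T i f * g i x =
          (s : ℂ)⁻¹ * ∑ h ∈ F, a h * z h x := by
        have e1 : (f : Cube d → ℂ) x = ∑ h ∈ F, b h * character h x := by
          rw [hf]
          change evalFunctional α γ x _ = _
          rw [map_sum]
          refine Finset.sum_congr rfl fun h _ => ?_
          rw [map_smul]; rfl
        have e2 : ∑ i, T i f * g i x = ∑ h ∈ F, b h * ∑ i, T i (charElt α γ h) * g i x := by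
          simp only [hf, map_sum, map_smul, smul_eq_mul, Finset.sum_mul, Finset.mul_sum]
          rw [Finset.sum_comm]
          exact Finset.sum_congr rfl fun _ _ => Finset.sum_congr rfl fun _ _ => by ring
        rw [e1, e2, ← Finset.sum_sub_distrib, Finset.mul_sum]
        refine Finset.sum_congr rfl fun h _ => ?_
        simp only [hz, charError, b]; ring
      rw [h3, ← ofReal_norm, ENNReal.ofReal_le_ofReal_iff hB0, norm_mul, norm_inv,
        Complex.norm_real, Real.norm_of_nonneg hspos.le, inv_mul_le_iff₀ hspos] at h2
      rw [← hs2, ← mul_pow, mul_comm B]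
      exact pow_le_pow_left₀ (norm_nonneg _) h2 2
  have hall : ∀ᵐ x, ∑ h ∈ F, ‖z h x‖ ^ 2 ≤ B ^ 2 := by
    have hdense := ae_all_iff.mpr fun i : ℕ =>
      hfix (TopologicalSpace.denseSeq ((Fin d → ℤ) → ℂ) i)
    filter_upwards [hdense] with x hx
    have hcl : IsClosed {a : (Fin d → ℤ) → ℂ | ‖∑ h ∈ F, a h * z h x‖ ^ 2 ≤
        B ^ 2 * ∑ h ∈ F, ‖a h‖ ^ 2} := by
      refine isClosed_le ?_ ?_ <;> fun_prop
    have h1 : ∀ a : (Fin d → ℤ) → ℂ, ‖∑ h ∈ F, a h * z h x‖ ^ 2 ≤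
        B ^ 2 * ∑ h ∈ F, ‖a h‖ ^ 2 := fun a =>
      DenseRange.induction_on (TopologicalSpace.denseRange_denseSeq ((Fin d → ℤ) → ℂ)) a hcl hx
    have h2 := h1 fun h => (starRingEnd ℂ) (z h x)
    simp only [RCLike.norm_conj] at h2
    have h3 : ∑ h ∈ F, (starRingEnd ℂ) (z h x) * z h x = ((∑ h ∈ F, ‖z h x‖ ^ 2 : ℝ) : ℂ) := by
      push_cast
      refine Finset.sum_congr rfl fun h _ => ?_
      rw [mul_comm, Complex.mul_conj, Complex.normSq_eq_norm_sq]; push_cast; rfl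
    have h4 : 0 ≤ ∑ h ∈ F, ‖z h x‖ ^ 2 := Finset.sum_nonneg fun h _ => sq_nonneg _
    rw [h3, Complex.norm_real, Real.norm_of_nonneg h4] at h2
    rcases h4.eq_or_lt with h5 | h5
    · rw [← h5]; positivity
    · rw [sq (∑ h ∈ F, ‖z h x‖ ^ 2)] at h2
      exact le_of_mul_le_mul_right h2 h5
  have hzi : ∀ h, Integrable (fun x => ‖charError T g h x‖ ^ 2) volume := fun h =>
    (memLp_charError T hg h).integrable_norm_pow two_ne_zero
  have hzn : ∀ h x, ‖z h x‖ ^ 2 = decayProd α γ h * ‖charError T g h x‖ ^ 2 := by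
    intro h x
    simp only [hz, norm_mul, Complex.norm_real, Real.norm_eq_abs, mul_pow, sq_abs,
      Real.sq_sqrt (hρ h).le]
  simp only [hzn] at hall
  calc ∑ h ∈ F, decayProd α γ h * ∫ x, ‖charError T g h x‖ ^ 2
      = ∫ x, ∑ h ∈ F, decayProd α γ h * ‖charError T g h x‖ ^ 2 := by
        rw [integral_finsetSum _ fun h _ => (hzi h).const_mul _]
        simp only [integral_const_mul]
    _ ≤ ∫ _x : Cube d, B ^ 2 := integral_mono_ae
        (integrable_finsetSum _ fun h _ => (hzi h).const_mul _) (integrable_const _) hall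
    _ = B ^ 2 := by simp

theorem ofReal_le_minimalError_sq (hγ : ∀ j, 0 < γ j) {L : InfoClass} {n : ℕ} {Q : ℝ}
    (hQ : ∀ (T : Fin n → (Space α γ d →ₗ[ℂ] ℂ)) (g : Fin n → Cube d → ℂ),
      (∀ i, MemLp (g i) 2 volume) → ∃ F : Finset (Fin d → ℤ),
      Q ≤ ∑ h ∈ F, decayProd α γ h * ∫ x, ‖charError T g h x‖ ^ 2) :
    ENNReal.ofReal Q ≤ minimalError α γ d L n ^ 2 := by
  have h1 : ENNReal.ofReal (Real.sqrt Q) ≤ minimalError α γ d L n := by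
    refine le_iInf fun T => le_iInf fun g => le_iInf fun _ => le_iInf fun hg => ?_
    by_cases htop : worstCaseError T g = ⊤
    · rw [htop]; exact le_top
    have hg2 : ∀ i, MemLp (g i) 2 volume := fun i => (hg i).mono_exponent le_top
    obtain ⟨F, hF⟩ := hQ T g hg2
    have h2 := sum_decayProd_mul_integral_le hγ T hg2 ENNReal.toReal_nonneg
      (ENNReal.ofReal_toReal htop).ge F
    refine ENNReal.ofReal_le_of_le_toReal ?_
    exact Real.sqrt_le_iff.mpr ⟨ENNReal.toReal_nonneg, hF.trans h2⟩
  rcases le_or_gt Q 0 with h | h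
  · rw [ENNReal.ofReal_of_nonpos h]; exact zero_le
  · rw [← Real.sq_sqrt h.le, ENNReal.ofReal_pow (Real.sqrt_nonneg _)]
    exact pow_le_pow_left' h1 2

theorem sum_sub_le_minimalError_sq (hα : 0 < α) (hγ : ∀ j, 0 < γ j) (hγ1 : ∀ j, γ j ≤ 1)
    (L : InfoClass) (n : ℕ) (F : Finset (Fin d → ℤ)) :
    ENNReal.ofReal (∑ h ∈ F, decayProd α γ h - n) ≤ minimalError α γ d L n ^ 2 :=
  ofReal_le_minimalError_sq hγ fun T _ hg => ⟨F, sum_sub_card_le_sum_integral T hg F _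
    (fun h => (decayProd_pos hγ h).le) fun h => decayProd_le_one hα hγ hγ1 h⟩

theorem mul_card_sub_le_minimalError_sq (hγ : ∀ j, 0 < γ j)
    (L : InfoClass) (n : ℕ) (F : Finset (Fin d → ℤ)) {ρ : ℝ} (hρ0 : 0 ≤ ρ)
    (hρ : ∀ h ∈ F, ρ ≤ decayProd α γ h) :
    ENNReal.ofReal (ρ * (F.card - n)) ≤ minimalError α γ d L n ^ 2 := by
  refine ofReal_le_minimalError_sq hγ fun T g hg => ⟨F, ?_⟩
  have h1 := sum_sub_card_le_sum_integral T hg F (fun _ => 1) (fun _ => zero_le_one)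
    (fun _ => le_rfl)
  simp only [Finset.sum_const, nsmul_eq_mul, mul_one, one_mul] at h1
  refine (mul_le_mul_of_nonneg_left h1 hρ0).trans ?_
  rw [Finset.mul_sum]
  exact Finset.sum_le_sum fun h hh => mul_le_mul_of_nonneg_right (hρ h hh)
    (integral_nonneg fun x => sq_nonneg _)

theorem le_one_of_antitone (hγ_le : γ 0 ≤ 1) (hγ_anti : Antitone γ) (j : ℕ) : γ j ≤ 1 :=
  (hγ_anti (Nat.zero_le j)).trans hγ_le

theorem tsum_decayProd_ne_top (hα : 1 < α) (hγ : ∀ j, 0 < γ j) :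
    ∑' h : Fin d → ℤ, ENNReal.ofReal (decayProd α γ h) ≠ ⊤ := by
  have h := tsum_decayProd_rpow_le hγ (α := α) (τ := 1) (by linarith) d
  simp only [Real.rpow_one] at h
  exact ne_top_of_le_ne_top ENNReal.ofReal_ne_top h

theorem one_le_tsum_decayProd :
    1 ≤ ∑' h : Fin d → ℤ, ENNReal.ofReal (decayProd α γ h) := by
  refine le_trans (le_of_eq ?_) (ENNReal.le_tsum (0 : Fin d → ℤ))
  rw [decayProd_zero, ENNReal.ofReal_one]

theorem factor_sq_le (hγ : ∀ j, 0 < γ j) (c : Criterion) :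
    c.factor α γ d ^ 2 ≤ ∑' h : Fin d → ℤ, ENNReal.ofReal (decayProd α γ h) := by
  cases c with
  | absolute => simpa [Criterion.factor] using one_le_tsum_decayProd
  | normalized => exact initialError_sq_le hγ

theorem one_le_factor (c : Criterion) : 1 ≤ c.factor α γ d := by
  cases c with
  | absolute => exact le_rfl
  | normalized => exact one_le_initialError

theorem exists_of_infoComplexity_le {L : InfoClass} {c : Criterion} {ε b : ℝ}
    (h : (infoComplexity α γ L c d ε : ℝ≥0∞) ≤ ENNReal.ofReal b) :
    ∃ n : ℕ, (n : ℝ≥0∞) ≤ ENNReal.ofReal b ∧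
      minimalError α γ d L n ≤ ENNReal.ofReal ε * c.factor α γ d := by
  classical
  by_cases hex : ∃ n : ℕ, minimalError α γ d L n ≤ ENNReal.ofReal ε * c.factor α γ d
  · refine ⟨Nat.find hex, le_trans ?_ h, Nat.find_spec hex⟩
    have : ((Nat.find hex : ℕ) : ℕ∞) ≤ infoComplexity α γ L c d ε :=
      le_iInf₂ fun n hn => by exact_mod_cast Nat.find_min' hex hn
    exact_mod_cast this
  · exfalso
    have : infoComplexity α γ L c d ε = ⊤ := by
      unfold infoComplexity
      simp only [iInf_eq_top]
      intro n hn
      exact absurd ⟨n, hn⟩ hex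
    rw [this] at h
    simp at h

theorem infoComplexity_le {L : InfoClass} {c : Criterion} {ε : ℝ} {n : ℕ}
    (h : minimalError α γ d L n ≤ ENNReal.ofReal ε) : infoComplexity α γ L c d ε ≤ n :=
  iInf₂_le n (h.trans (le_mul_of_one_le_right' (one_le_factor c)))

theorem tsum_decayProd_le_of_minimalError_le (hα : 0 < α) (hγ : ∀ j, 0 < γ j)
    (hγ1 : ∀ j, γ j ≤ 1) {L : InfoClass} {c : Criterion} {ε : ℝ} {n : ℕ}
    (h : minimalError α γ d L n ≤ ENNReal.ofReal ε * c.factor α γ d) :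
    ∑' h : Fin d → ℤ, ENNReal.ofReal (decayProd α γ h) ≤
      n + ENNReal.ofReal ε ^ 2 * ∑' h : Fin d → ℤ, ENNReal.ofReal (decayProd α γ h) := by
  conv_lhs => rw [ENNReal.tsum_eq_iSup_sum]
  refine iSup_le fun F => ?_
  have h1 := sum_sub_le_minimalError_sq hα hγ hγ1 L n F
  have h2 : minimalError α γ d L n ^ 2 ≤
      ENNReal.ofReal ε ^ 2 * ∑' h : Fin d → ℤ, ENNReal.ofReal (decayProd α γ h) := by
    refine (pow_le_pow_left' h 2).trans ?_
    rw [mul_pow]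
    exact mul_le_mul_right (factor_sq_le hγ c) _
  rw [← ENNReal.ofReal_sum_of_nonneg fun h _ => (decayProd_pos hγ h).le]
  calc ENNReal.ofReal (∑ h ∈ F, decayProd α γ h)
      = ENNReal.ofReal (n + (∑ h ∈ F, decayProd α γ h - n)) := by ring_nf
    _ ≤ ENNReal.ofReal n + ENNReal.ofReal (∑ h ∈ F, decayProd α γ h - n) := ENNReal.ofReal_add_le
    _ ≤ _ := add_le_add (by rw [ENNReal.ofReal_natCast]) (h1.trans h2)

theorem one_le_infoComplexity (hα : 1 < α) (hγ : ∀ j, 0 < γ j)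
    (hγ1 : ∀ j, γ j ≤ 1) (L : InfoClass) (c : Criterion) {ε : ℝ} (hε : ε < 1) :
    1 ≤ infoComplexity α γ L c d ε := by
  refine le_iInf₂ fun n hn => ?_
  have h1 := tsum_decayProd_le_of_minimalError_le (by linarith) hγ hγ1 hn
  by_contra hlt
  have hn0 : n = 0 := by
    have : (n : ℕ∞) < 1 := lt_of_not_ge hlt
    exact_mod_cast Order.lt_one_iff.mp (by exact_mod_cast this)
  rw [hn0, Nat.cast_zero, zero_add] at h1
  have hS := tsum_decayProd_ne_top (d := d) hα hγ
  have hS1 := one_le_tsum_decayProd (α := α) (γ := γ) (d := d)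
  set S := ∑' h : Fin d → ℤ, ENNReal.ofReal (decayProd α γ h)
  have h2 : ENNReal.ofReal ε ^ 2 < 1 := pow_lt_one' (by simpa using hε) two_ne_zero
  have h3 : ENNReal.ofReal ε ^ 2 * S < 1 * S :=
    ENNReal.mul_lt_mul_left (by positivity) hS h2
  rw [one_mul] at h3
  exact absurd h1 (not_le.mpr h3)

theorem tsum_decayProd_le_two_mul (hα : 1 < α) (hγ : ∀ j, 0 < γ j)
    (hγ1 : ∀ j, γ j ≤ 1) {L : InfoClass} {c : Criterion} {b : ℝ}
    (h : (infoComplexity α γ L c d (1 / 2) : ℝ≥0∞) ≤ ENNReal.ofReal b) :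
    ∑' h : Fin d → ℤ, ENNReal.ofReal (decayProd α γ h) ≤ ENNReal.ofReal (2 * b) := by
  obtain ⟨n, hn, hne⟩ := exists_of_infoComplexity_le h
  have h1 := tsum_decayProd_le_of_minimalError_le (by linarith) hγ hγ1 hne
  have hS := tsum_decayProd_ne_top (d := d) hα hγ
  set S := ∑' h : Fin d → ℤ, ENNReal.ofReal (decayProd α γ h)
  have h2 : ENNReal.ofReal (1 / 2) ^ 2 * S ≤ ENNReal.ofReal (1 / 2) * S := by
    refine mul_le_mul_left ?_ S
    rw [sq]
    exact mul_le_of_le_one_left' (by simp)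
  obtain ⟨s, hs0, hs⟩ : ∃ s : ℝ, 0 ≤ s ∧ S = ENNReal.ofReal s :=
    ⟨S.toReal, ENNReal.toReal_nonneg, (ENNReal.ofReal_toReal hS).symm⟩
  have h3 : S ≤ ENNReal.ofReal b + ENNReal.ofReal (1 / 2) * S := h1.trans (add_le_add hn h2)
  rcases le_or_gt b 0 with hb | hb
  · rw [ENNReal.ofReal_of_nonpos hb, zero_add, hs, ← ENNReal.ofReal_mul (by norm_num),
      ENNReal.ofReal_le_ofReal_iff (by positivity)] at h3
    rw [hs, show s = 0 by linarith]; simp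
  · rw [hs, ← ENNReal.ofReal_mul (by norm_num), ← ENNReal.ofReal_add hb.le (by positivity),
      ENNReal.ofReal_le_ofReal_iff (by positivity)] at h3
    rw [hs]
    exact ENNReal.ofReal_le_ofReal (by linarith)

theorem sum_le_two_mul_log (hα : 1 < α) (hγ : ∀ j, 0 < γ j)
    (hγ1 : ∀ j, γ j ≤ 1) {L : InfoClass} {c : Criterion} {b : ℝ}
    (h : (infoComplexity α γ L c d (1 / 2) : ℝ≥0∞) ≤ ENNReal.ofReal b) :
    ∑ j ∈ Finset.range d, γ j ≤ 2 * Real.log (2 * b) := by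
  have h1 := (prod_one_add_le_tsum_decayProd (α := α) hγ d).trans
    (tsum_decayProd_le_two_mul hα hγ hγ1 h)
  have hpos : 0 < ∏ j ∈ Finset.range d, (1 + γ j) :=
    Finset.prod_pos fun j _ => by have := hγ j; positivity
  have hb : 0 < 2 * b := by
    by_contra hb
    rw [ENNReal.ofReal_of_nonpos (not_lt.mp hb), nonpos_iff_eq_zero, ENNReal.ofReal_eq_zero] at h1
    linarith
  rw [ENNReal.ofReal_le_ofReal_iff hb.le] at h1
  have h2 := Real.log_le_log hpos h1
  rw [Real.log_prod fun j _ => by have := hγ j; positivity] at h2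
  have h3 : ∑ j ∈ Finset.range d, γ j / 2 ≤ ∑ j ∈ Finset.range d, Real.log (1 + γ j) := by
    refine Finset.sum_le_sum fun j _ => ?_
    have h0 := hγ j
    have := Real.one_sub_inv_le_log_of_pos (show 0 < 1 + γ j by linarith)
    refine le_trans ?_ this
    have h4 : 1 - (1 + γ j)⁻¹ = γ j / (1 + γ j) := by field_simp; ring
    rw [h4]
    exact div_le_div_of_nonneg_left h0.le (by linarith) (by linarith [hγ1 j])
  rw [← Finset.sum_div] at h3
  linarith

/-- An error bound `C n^{-r}` gives a bound `2 (C/ε)^{1/r}` of the information complexity. -/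
theorem infoComplexity_le_of_rate {L : InfoClass} (c : Criterion) {C r ε : ℝ} (hC : 1 ≤ C)
    (hr : 0 < r) (hε : 0 < ε) (hε1 : ε < 1)
    (h : ∀ n : ℕ, 1 ≤ n → minimalError α γ d L n ≤ ENNReal.ofReal (C * (n : ℝ) ^ (-r))) :
    (infoComplexity α γ L c d ε : ℝ≥0∞) ≤ ENNReal.ofReal (2 * (C / ε) ^ (1 / r)) := by
  have hC0 : 0 < C := by linarith
  set x : ℝ := (C / ε) ^ (1 / r) with hx
  have hx1 : 1 ≤ x := Real.one_le_rpow (by rw [one_le_div hε]; linarith) (by positivity)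
  have hn1 : 1 ≤ ⌈x⌉₊ := Nat.one_le_ceil_iff.mpr (by linarith)
  have hle : minimalError α γ d L ⌈x⌉₊ ≤ ENNReal.ofReal ε := by
    refine (h _ hn1).trans (ENNReal.ofReal_le_ofReal ?_)
    calc C * (⌈x⌉₊ : ℝ) ^ (-r) ≤ C * x ^ (-r) := by
          refine mul_le_mul_of_nonneg_left ?_ hC0.le
          exact Real.rpow_le_rpow_of_nonpos (by linarith) (Nat.le_ceil x) (by linarith)
      _ = ε := by
          rw [hx, ← Real.rpow_mul (by positivity), show 1 / r * -r = -1 by field_simp,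
            Real.rpow_neg_one]
          field_simp
  have h1 : (infoComplexity α γ L c d ε : ℝ≥0∞) ≤ ((⌈x⌉₊ : ℕ) : ℝ≥0∞) := by
    exact_mod_cast infoComplexity_le (c := c) hle
  refine h1.trans ?_
  rw [← ENNReal.ofReal_natCast]
  exact ENNReal.ofReal_le_ofReal (by linarith [Nat.ceil_lt_add_one (show 0 ≤ x by linarith)])

theorem summable_rpow_mono (hγ : ∀ j, 0 < γ j) (hγ1 : ∀ j, γ j ≤ 1) {κ τ : ℝ} (hκτ : κ ≤ τ)
    (h : Summable fun j => γ j ^ κ) : Summable fun j => γ j ^ τ :=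
  h.of_nonneg_of_le (fun j => Real.rpow_nonneg (hγ j).le _)
    fun j => Real.rpow_le_rpow_of_exponent_ge (hγ j) (hγ1 j) hκτ

theorem summable_of_sExponent_lt (hγ : ∀ j, 0 < γ j) (hγ1 : ∀ j, γ j ≤ 1) {τ : ℝ}
    (h : sExponent γ < τ) : Summable fun j => γ j ^ τ := by
  obtain ⟨_, ⟨κ, ⟨_, hκ⟩, rfl⟩, hlt⟩ := sInf_lt_iff.mp h
  exact summable_rpow_mono hγ hγ1 (EReal.coe_le_coe_iff.mp hlt.le) hκ

theorem sExponent_le {κ : ℝ} (hκ : 0 < κ) (h : Summable fun j => γ j ^ κ) :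
    sExponent γ ≤ κ := sInf_le ⟨κ, ⟨hκ, h⟩, rfl⟩

theorem tExponent_le {κ : ℝ} (hκ : 0 < κ) (h : LogSumBounded γ κ) :
    tExponent γ ≤ κ := sInf_le ⟨κ, ⟨hκ, h⟩, rfl⟩

theorem uExponent_le {κ σ : ℝ} (hκ : 0 < κ) (h : PowSumVanishes γ σ κ) :
    uExponent γ σ ≤ κ := sInf_le ⟨κ, ⟨hκ, h⟩, rfl⟩

theorem zero_le_tExponent : 0 ≤ tExponent γ := by
  refine le_sInf ?_
  rintro _ ⟨κ, ⟨hκ, _⟩, rfl⟩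
  exact EReal.coe_nonneg.mpr hκ.le

theorem logSumBounded_of_le {κ A : ℝ} (h : ∀ d : ℕ, 1 ≤ d →
    ∑ j ∈ Finset.range d, γ j ^ κ ≤ A * Real.log ((d : ℝ) + 1)) : LogSumBounded γ κ := by
  refine lt_of_le_of_lt (limsup_le_of_le (a := (A : EReal)) (by isBoundedDefault) ?_)
    (EReal.coe_lt_top A)
  filter_upwards [eventually_ge_atTop 1] with d hd
  have hlog : 0 < Real.log ((d : ℝ) + 1) := Real.log_pos (by
    have : (1 : ℝ) ≤ d := by exact_mod_cast hd
    linarith)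
  rw [EReal.coe_le_coe_iff, one_div, inv_mul_le_iff₀ hlog, mul_comm]
  exact h d hd

theorem log_two_le_log_add_one {d : ℕ} (hd : 1 ≤ d) : Real.log 2 ≤ Real.log ((d : ℝ) + 1) := by
  refine Real.log_le_log two_pos ?_
  have : (1 : ℝ) ≤ d := by exact_mod_cast hd
  linarith

theorem logSumBounded_of_summable (hγ : ∀ j, 0 < γ j) {κ : ℝ} (h : Summable fun j => γ j ^ κ) :
    LogSumBounded γ κ := by
  refine logSumBounded_of_le (A := (∑' j, γ j ^ κ) / Real.log 2) fun d hd => ?_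
  have h1 := h.sum_le_tsum (Finset.range d) fun j _ => Real.rpow_nonneg (hγ j).le _
  have h2 : 0 ≤ ∑' j, γ j ^ κ := tsum_nonneg fun j => Real.rpow_nonneg (hγ j).le _
  have hl2 : 0 < Real.log 2 := Real.log_pos one_lt_two
  rw [div_mul_eq_mul_div, le_div_iff₀ hl2]
  exact mul_le_mul h1 (log_two_le_log_add_one hd) hl2.le h2

theorem tExponent_le_sExponent (hγ : ∀ j, 0 < γ j) : tExponent γ ≤ sExponent γ := by
  refine le_sInf ?_
  rintro _ ⟨κ, ⟨hκ, hs⟩, rfl⟩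
  exact tExponent_le hκ (logSumBounded_of_summable hγ hs)

/-- For nonincreasing weights, a logarithmic bound of the partial sums of `γ_j^κ` makes all larger
powers summable. -/
theorem summable_of_logSumBounded (hγ : ∀ j, 0 < γ j) (hγ_anti : Antitone γ) {κ τ : ℝ}
    (hκ : 0 < κ) (hκτ : κ < τ) (h : LogSumBounded γ κ) : Summable fun j => γ j ^ τ := by
  obtain ⟨A, hA, _⟩ := EReal.lt_iff_exists_real_btwn.mp h
  have hev := eventually_lt_of_limsup_lt hA
  set p : ℝ := τ / κ with hp
  have hp1 : 1 < p := (one_lt_div hκ).mpr hκτ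
  set η : ℝ := (p - 1) / (2 * p) with hη
  have hη0 : 0 < η := div_pos (by linarith) (by linarith)
  have hηp : (1 - η) * p = (p + 1) / 2 := by rw [hη]; field_simp; ring
  set B : ℝ := (max A 0) * (2 ^ η / η) with hB
  have hB0 : 0 ≤ B := by positivity
  have hsum : Summable fun k : ℕ => B ^ p * ((k + 1 : ℕ) : ℝ) ^ (-((p + 1) / 2)) :=
    ((summable_nat_add_iff 1).mpr
      (Real.summable_nat_rpow.mpr (by linarith : -((p + 1) / 2) < -1))).mul_left _
  refine hsum.of_norm_bounded_eventually_nat ?_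
  filter_upwards [(tendsto_add_atTop_nat 1).eventually hev] with k hk
  rw [EReal.coe_lt_coe_iff, one_div] at hk
  have hk0 : (0 : ℝ) < ((k + 1 : ℕ) : ℝ) := by positivity
  have hk1 : (1 : ℝ) ≤ ((k + 1 : ℕ) : ℝ) := by push_cast; linarith [(Nat.cast_nonneg k : (0:ℝ) ≤ k)]
  have hlog : 0 < Real.log (((k + 1 : ℕ) : ℝ) + 1) := Real.log_pos (by linarith)
  rw [inv_mul_lt_iff₀ hlog] at hk
  have h1 : ((k + 1 : ℕ) : ℝ) * γ k ^ κ ≤ ∑ j ∈ Finset.range (k + 1), γ j ^ κ := by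
    have := Finset.card_nsmul_le_sum (Finset.range (k + 1)) (fun j => γ j ^ κ) (γ k ^ κ)
      fun j hj => Real.rpow_le_rpow (hγ k).le
        (hγ_anti (Nat.lt_succ_iff.mp (Finset.mem_range.mp hj))) hκ.le
    rwa [Finset.card_range, nsmul_eq_mul] at this
  have h2 : Real.log (((k + 1 : ℕ) : ℝ) + 1) ≤ 2 ^ η / η * ((k + 1 : ℕ) : ℝ) ^ η := by
    refine (Real.log_le_rpow_div (by linarith) hη0).trans ?_
    rw [div_mul_eq_mul_div, ← Real.mul_rpow two_pos.le hk0.le]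
    gcongr
    linarith
  have h3 : γ k ^ κ ≤ B * ((k + 1 : ℕ) : ℝ) ^ (-(1 - η)) := by
    have h4 : ((k + 1 : ℕ) : ℝ) * γ k ^ κ ≤ B * ((k + 1 : ℕ) : ℝ) ^ η := by
      calc _ ≤ Real.log (((k + 1 : ℕ) : ℝ) + 1) * max A 0 :=
            h1.trans (hk.le.trans (mul_le_mul_of_nonneg_left (le_max_left _ _) hlog.le))
        _ ≤ (2 ^ η / η * ((k + 1 : ℕ) : ℝ) ^ η) * max A 0 :=
            mul_le_mul_of_nonneg_right h2 (le_max_right _ _)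
        _ = _ := by rw [hB]; ring
    rw [neg_sub, Real.rpow_sub_one hk0.ne', ← mul_div_assoc, le_div_iff₀ hk0, mul_comm]
    exact h4
  rw [Real.norm_of_nonneg (Real.rpow_nonneg (hγ k).le _)]
  calc γ k ^ τ = (γ k ^ κ) ^ p := by
        rw [← Real.rpow_mul (hγ k).le, hp, mul_div_cancel₀ _ hκ.ne']
    _ ≤ (B * ((k + 1 : ℕ) : ℝ) ^ (-(1 - η))) ^ p :=
        Real.rpow_le_rpow (Real.rpow_nonneg (hγ k).le _) h3 (by linarith)
    _ = _ := by
        rw [Real.mul_rpow hB0 (by positivity), ← Real.rpow_mul hk0.le, neg_mul, hηp]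

theorem summable_of_tExponent_lt (hγ : ∀ j, 0 < γ j) (hγ_anti : Antitone γ) {τ : ℝ}
    (h : tExponent γ < τ) : Summable fun j => γ j ^ τ := by
  obtain ⟨_, ⟨κ, ⟨hκ0, hκ⟩, rfl⟩, hlt⟩ := sInf_lt_iff.mp h
  exact summable_of_logSumBounded hγ hγ_anti hκ0 (EReal.coe_lt_coe_iff.mp hlt) hκ

theorem sExponent_lt_one_iff (hγ : ∀ j, 0 < γ j) (hγ_anti : Antitone γ) :
    sExponent γ < 1 ↔ tExponent γ < 1 := by
  refine ⟨fun h => (tExponent_le_sExponent hγ).trans_lt h, fun h => ?_⟩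
  obtain ⟨κ, hκ, hκ1⟩ := EReal.lt_iff_exists_real_btwn.mp h
  have hκ0 : 0 < κ := by exact_mod_cast (zero_le_tExponent.trans_lt hκ)
  exact (sExponent_le hκ0 (summable_of_tExponent_lt hγ hγ_anti hκ)).trans_lt hκ1

/-- The 0/1 frequency vectors with exactly `m` ones. -/
def indicatorFrequencies (d m : ℕ) : Finset (Fin d → ℤ) :=
  (Finset.powersetCard m (Finset.univ : Finset (Fin d))).image
    fun s j => if j ∈ s then 1 else 0

theorem card_indicatorFrequencies (d m : ℕ) : (indicatorFrequencies d m).card = d.choose m := by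
  unfold indicatorFrequencies
  rw [Finset.card_image_of_injective, Finset.card_powersetCard, Finset.card_univ, Fintype.card_fin]
  intro s t hst
  ext j
  have := congrFun hst j
  by_cases h1 : j ∈ s <;> by_cases h2 : j ∈ t <;> simp_all

theorem pow_le_decayProd_indicator (hγ : ∀ j, 0 < γ j) (hγ_anti : Antitone γ) {k m : ℕ}
    {h : Fin (k + 1) → ℤ} (hh : h ∈ indicatorFrequencies (k + 1) m) :
    γ k ^ m ≤ decayProd α γ h := by
  obtain ⟨s, hs, rfl⟩ := Finset.mem_image.mp hh
  have hcard := (Finset.mem_powersetCard.mp hs).2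
  have h1 : decayProd α γ (fun j : Fin (k + 1) => if j ∈ s then (1 : ℤ) else 0) =
      ∏ j ∈ s, γ j := by
    unfold decayProd
    rw [← Finset.prod_subset (Finset.subset_univ s)
      (f := fun j : Fin (k + 1) => decay α (γ j) (if j ∈ s then (1 : ℤ) else 0))]
    · refine Finset.prod_congr rfl fun j hj => ?_
      simp [hj, decay]
    · intro j _ hj
      simp [hj, decay]
  rw [h1, ← hcard, ← Finset.prod_const]
  exact Finset.prod_le_prod (fun j _ => (hγ k).le) fun j _ => hγ_anti (Nat.lt_succ_iff.mp j.2)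

theorem div_two_pow_div_factorial_le_choose {d m : ℕ} (hd : 2 * m ≤ d) :
    ((d : ℝ) / 2) ^ m / (m.factorial : ℝ) ≤ d.choose m := by
  refine le_trans ?_ (Nat.pow_le_choose m d)
  refine div_le_div_of_nonneg_right ?_ (by positivity)
  refine pow_le_pow_left₀ (by positivity) ?_ m
  rw [Nat.cast_sub (by omega)]
  have : (2 : ℝ) * m ≤ d := by exact_mod_cast hd
  push_cast
  linarith

/-- Polynomial tractability forces polynomial decay of the weights faster than `1/j`. -/
theorem sExponent_lt_one_of_isPT (hα : 1 < α) (hγ : ∀ j, 0 < γ j) (hγ1 : ∀ j, γ j ≤ 1)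
    (hγ_anti : Antitone γ) {L : InfoClass} {c : Criterion} (h : IsPT α γ L c) :
    sExponent γ < 1 := by
  obtain ⟨T, σ, C, hT, hσ, hC, hPT⟩ := h
  set a : ℝ := σ + 1 with ha
  set m : ℕ := ⌈a * T + σ⌉₊ + 1 with hm
  have hmT : a * T + σ < m := by
    rw [hm]; push_cast; linarith [Nat.le_ceil (a * T + σ)]
  have hm0 : (0 : ℝ) < m := by rw [hm]; positivity
  set C₁ : ℝ := 2 * (C * (1 / 2) ^ (-T)) with hC₁
  have hC₁0 : 0 ≤ C₁ := by positivity
  have hS : ∀ d : ℕ, 1 ≤ d → ∑' h : Fin d → ℤ, ENNReal.ofReal (decayProd α γ h) ≤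
      ENNReal.ofReal (C₁ * (d : ℝ) ^ σ) := by
    intro d hd
    have := tsum_decayProd_le_two_mul hα hγ hγ1 (hPT d hd (1 / 2) (by norm_num) (by norm_num))
    rwa [hC₁, mul_assoc]
  set q : ℝ := (2 : ℝ) ^ m * m.factorial with hq
  have hq0 : 0 < q := by positivity
  have hsmall : ∀ᶠ d : ℕ in atTop, 2 * C * q * (d : ℝ) ^ (a * T + σ - m) ≤ 1 := by
    have h1 : Tendsto (fun d : ℕ => 2 * C * q * (d : ℝ) ^ (-((m : ℝ) - (a * T + σ)))) atTop
        (𝓝 (2 * C * q * 0)) :=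
      ((tendsto_rpow_neg_atTop (by linarith : 0 < (m : ℝ) - (a * T + σ))).comp
        tendsto_natCast_atTop_atTop).const_mul _
    rw [mul_zero] at h1
    filter_upwards [h1.eventually_le_const one_pos] with d hd
    simpa [neg_sub] using hd
  set C₂ : ℝ := 2 * C₁ * q with hC₂
  have hC₂0 : 0 ≤ C₂ := by positivity
  have hmain : ∀ᶠ k : ℕ in atTop,
      γ k ^ m ≤ C₂ * ((k + 1 : ℕ) : ℝ) ^ (-(m + (σ + 2))) := by
    filter_upwards [(tendsto_add_atTop_nat 1).eventually hsmall,
      (tendsto_add_atTop_nat 1).eventually (eventually_ge_atTop (2 * m)),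
      eventually_ge_atTop 1] with k hk1 hk2 hk3
    set D : ℝ := ((k + 1 : ℕ) : ℝ) with hD
    have hD1 : 1 < D := by
      rw [hD]; push_cast
      have : (1 : ℝ) ≤ k := by exact_mod_cast hk3
      linarith
    have hD0 : 0 < D := by linarith
    have hε1 : D ^ (-a) < 1 := Real.rpow_lt_one_of_one_lt_of_neg hD1 (by linarith)
    obtain ⟨n, hn, hne⟩ := exists_of_infoComplexity_le
      (hPT (k + 1) (by omega) (D ^ (-a)) (by positivity) hε1)
    have hnle : (n : ℝ) ≤ C * D ^ (a * T + σ) := by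
      rw [← ENNReal.ofReal_natCast, ENNReal.ofReal_le_ofReal_iff (by positivity)] at hn
      refine hn.trans (le_of_eq ?_)
      rw [← hD, ← Real.rpow_mul hD0.le, mul_assoc, ← Real.rpow_add hD0]
      ring_nf
    have hcard : D ^ (m : ℝ) / q ≤ ((k + 1).choose m : ℝ) := by
      have := div_two_pow_div_factorial_le_choose hk2
      rwa [div_pow, div_div, ← hq, ← hD, ← Real.rpow_natCast D] at this
    have hnhalf : (n : ℝ) ≤ D ^ (m : ℝ) / q / 2 := by
      refine hnle.trans ?_
      rw [le_div_iff₀ two_pos, le_div_iff₀ hq0]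
      have : D ^ (a * T + σ) = D ^ (a * T + σ - m) * D ^ (m : ℝ) := by
        rw [← Real.rpow_add hD0]; ring_nf
      rw [this]
      calc _ = (2 * C * q * D ^ (a * T + σ - m)) * D ^ (m : ℝ) := by ring
        _ ≤ 1 * D ^ (m : ℝ) := mul_le_mul_of_nonneg_right hk1 (by positivity)
        _ = _ := one_mul _
    have hlow := mul_card_sub_le_minimalError_sq (α := α) hγ L n
      (indicatorFrequencies (k + 1) m) (pow_nonneg (hγ k).le m)
      fun h hh => pow_le_decayProd_indicator hγ hγ_anti hh
    rw [card_indicatorFrequencies] at hlow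
    have hup : minimalError α γ (k + 1) L n ^ 2 ≤
        ENNReal.ofReal ((D ^ (-a)) ^ 2 * (C₁ * D ^ σ)) := by
      refine (pow_le_pow_left' hne 2).trans ?_
      rw [mul_pow, ENNReal.ofReal_mul (by positivity), ENNReal.ofReal_pow (by positivity)]
      exact mul_le_mul_right ((factor_sq_le hγ c).trans (hS (k + 1) (by omega))) _
    have h3 := hlow.trans hup
    rw [ENNReal.ofReal_le_ofReal_iff (by positivity)] at h3
    have h4 : γ k ^ m * (D ^ (m : ℝ) / q / 2) ≤ (D ^ (-a)) ^ 2 * (C₁ * D ^ σ) := by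
      refine le_trans (mul_le_mul_of_nonneg_left ?_ (pow_nonneg (hγ k).le m)) h3
      linarith
    have h5 : (D ^ (-a)) ^ 2 * D ^ σ = D ^ (-(m + (σ + 2))) * D ^ (m : ℝ) := by
      rw [← Real.rpow_natCast (D ^ (-a)), ← Real.rpow_mul hD0.le, ← Real.rpow_add hD0,
        ← Real.rpow_add hD0]
      congr 1; push_cast; rw [ha]; ring
    have hDm : 0 < D ^ (m : ℝ) := by positivity
    refine le_of_mul_le_mul_right ?_ hDm
    calc γ k ^ m * D ^ (m : ℝ) = γ k ^ m * (D ^ (m : ℝ) / q / 2) * (2 * q) := by field_simp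
      _ ≤ (D ^ (-a)) ^ 2 * (C₁ * D ^ σ) * (2 * q) := by gcongr
      _ = ((D ^ (-a)) ^ 2 * D ^ σ) * (2 * C₁ * q) := by ring
      _ = _ := by rw [h5]; ring
  set θ : ℝ := (σ + 2) / m with hθ
  have hθ0 : 0 < θ := by positivity
  set κ : ℝ := 1 / (1 + θ / 2) with hκ
  have hκ0 : 0 < κ := by positivity
  have hκ1 : κ < 1 := by rw [hκ, div_lt_one (by positivity)]; linarith
  have hexp : 1 < (1 + θ) * κ := by
    rw [hκ, mul_one_div, one_lt_div (by positivity)]; linarith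
  have hsum : Summable fun k : ℕ => C₂ ^ (κ / m) * ((k + 1 : ℕ) : ℝ) ^ (-((1 + θ) * κ)) :=
    ((summable_nat_add_iff 1).mpr
      (Real.summable_nat_rpow.mpr (by linarith : -((1 + θ) * κ) < -1))).mul_left _
  have hfin : Summable fun k => γ k ^ κ := by
    refine hsum.of_norm_bounded_eventually_nat ?_
    filter_upwards [hmain] with k hk
    have hD0 : (0 : ℝ) < ((k + 1 : ℕ) : ℝ) := by positivity
    rw [Real.norm_of_nonneg (Real.rpow_nonneg (hγ k).le _)]
    calc γ k ^ κ = (γ k ^ m) ^ (κ / m) := by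
          rw [← Real.rpow_natCast (γ k), ← Real.rpow_mul (hγ k).le]
          congr 1; field_simp
      _ ≤ (C₂ * ((k + 1 : ℕ) : ℝ) ^ (-(m + (σ + 2)))) ^ (κ / m) :=
          Real.rpow_le_rpow (pow_nonneg (hγ k).le _) hk (by positivity)
      _ = _ := by
          rw [Real.mul_rpow hC₂0 (by positivity), ← Real.rpow_mul hD0.le]
          congr 2; rw [hθ]; field_simp
  exact (sExponent_le hκ0 hfin).trans_lt (by exact_mod_cast hκ1)

theorem IsSPT.isPT {L : InfoClass} {c : Criterion} (h : IsSPT α γ L c) : IsPT α γ L c := by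
  obtain ⟨τ, C, hτ, hC, h⟩ := h
  exact ⟨τ, 0, C, hτ, le_rfl, hC, fun d hd ε h0 h1 => by simpa using h d hd ε h0 h1⟩

/-- The two error rates, with constants uniform in the dimension, when `∑ γ_j^τ` converges. -/
theorem exists_rates (hα : 1 < α) (hγ : ∀ j, 0 < γ j) (hγ1 : ∀ j, γ j ≤ 1) {τ : ℝ}
    (hατ : 1 / α < τ) (hτ1 : τ < 1) (hs : Summable fun j => γ j ^ τ) :
    (∃ C : ℝ, 1 ≤ C ∧ ∀ d n : ℕ, 1 ≤ n → minimalError α γ d .all n ≤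
      ENNReal.ofReal (C * (n : ℝ) ^ (-((1 - τ) / (2 * τ))))) ∧
    (∃ C : ℝ, 1 ≤ C ∧ ∀ d n : ℕ, 1 ≤ n → minimalError α γ d .std n ≤
      ENNReal.ofReal (C * (n : ℝ) ^ (-((1 - τ) / (2 * τ * (1 + τ)))))) := by
  have hα0 : 0 < α := by linarith
  have hτ0 : 0 < τ := lt_trans (by positivity) hατ
  have hατ' : 1 < α * τ := by rwa [div_lt_iff₀' hα0] at hατ
  set M : ℝ := Real.exp (intZeta (α * τ) * ∑' j, γ j ^ τ) with hM
  have hM1 : 1 ≤ M := Real.one_le_exp (mul_nonneg (intZeta_nonneg _)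
    (tsum_nonneg fun j => Real.rpow_nonneg (hγ j).le _))
  have hsum : ∀ d : ℕ, ∑' h : Fin d → ℤ, ENNReal.ofReal (decayProd α γ h ^ τ) ≤
      ENNReal.ofReal M := fun d =>
    (tsum_decayProd_rpow_le hγ hατ' d).trans <| ENNReal.ofReal_le_ofReal <|
      Real.exp_le_exp.mpr <| mul_le_mul_of_nonneg_left
        (hs.sum_le_tsum _ fun j _ => Real.rpow_nonneg (hγ j).le _) (intZeta_nonneg _)
  have hMp : 1 ≤ M ^ (1 / (2 * τ)) := Real.one_le_rpow hM1 (by positivity)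
  refine ⟨⟨_, hMp, fun d n hn => minimalError_all_le hγ hτ0 hτ1 hM1 (hsum d) hn⟩, ?_⟩
  obtain ⟨C, hC, h⟩ := exists_minimalError_std_le hτ0 hτ1
  exact ⟨C * M ^ (1 / (2 * τ)), one_le_mul_of_one_le_of_one_le hC hMp,
    fun d n hn => h α γ d M hα0 hγ hγ1 hM1 (hsum d) n hn⟩

theorem minimalError_le_std (hα : 1 < α) (hγ : ∀ j, 0 < γ j) (L : InfoClass) (n : ℕ) :
    minimalError α γ d L n ≤ minimalError α γ d .std n := by
  cases L with
  | all => exact minimalError_all_le_std hγ (tsum_decayProd_ne_top hα hγ) n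
  | std => exact le_rfl

theorem isSPT_of_sExponent_lt_one (hα : 1 < α) (hγ : ∀ j, 0 < γ j) (hγ1 : ∀ j, γ j ≤ 1)
    (h : sExponent γ < 1) (L : InfoClass) (c : Criterion) : IsSPT α γ L c := by
  have h1 : max ((1 / α : ℝ) : EReal) (sExponent γ) < 1 := by
    refine max_lt ?_ h
    have : 1 / α < 1 := by rw [div_lt_one (by linarith)]; exact hα
    exact_mod_cast this
  obtain ⟨τ, hτ, hτ1⟩ := EReal.lt_iff_exists_real_btwn.mp h1
  have hτ1' : τ < 1 := by exact_mod_cast hτ1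
  have hατ : 1 / α < τ := EReal.coe_lt_coe_iff.mp ((le_max_left _ _).trans_lt hτ)
  have hτ0 : 0 < τ := lt_trans (by positivity) hατ
  obtain ⟨_, C, hC, hrate⟩ := exists_rates hα hγ hγ1 hατ hτ1'
    (summable_of_sExponent_lt hγ hγ1 ((le_max_right _ _).trans_lt hτ))
  set r : ℝ := (1 - τ) / (2 * τ * (1 + τ)) with hr
  have hr0 : 0 < r := div_pos (by linarith) (by positivity)
  refine ⟨1 / r, 2 * C ^ (1 / r), by positivity, by positivity, fun d _ ε hε hε1 => ?_⟩
  refine (infoComplexity_le_of_rate c hC hr0 hε hε1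
    fun n hn => (minimalError_le_std hα hγ L n).trans (hrate d n hn)).trans (le_of_eq ?_)
  rw [Real.div_rpow (by linarith) hε.le, Real.rpow_neg hε.le, div_eq_mul_inv, mul_assoc]

theorem isSPT_iff (hα : 1 < α) (hγ : ∀ j, 0 < γ j) (hγ1 : ∀ j, γ j ≤ 1)
    (hγ_anti : Antitone γ) (L : InfoClass) (c : Criterion) :
    IsSPT α γ L c ↔ sExponent γ < 1 :=
  ⟨fun h => sExponent_lt_one_of_isPT hα hγ hγ1 hγ_anti h.isPT,
    fun h => isSPT_of_sExponent_lt_one hα hγ hγ1 h L c⟩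

theorem isPT_iff (hα : 1 < α) (hγ : ∀ j, 0 < γ j) (hγ1 : ∀ j, γ j ≤ 1)
    (hγ_anti : Antitone γ) (L : InfoClass) (c : Criterion) :
    IsPT α γ L c ↔ tExponent γ < 1 := by
  rw [← sExponent_lt_one_iff hγ hγ_anti]
  exact ⟨sExponent_lt_one_of_isPT hα hγ hγ1 hγ_anti,
    fun h => (isSPT_of_sExponent_lt_one hα hγ hγ1 h L c).isPT⟩

theorem logSumBounded_of_isQPT (hα : 1 < α) (hγ : ∀ j, 0 < γ j) (hγ1 : ∀ j, γ j ≤ 1)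
    {L : InfoClass} {c : Criterion} (h : IsQPT α γ L c) : LogSumBounded γ 1 := by
  obtain ⟨t, C, ht, hC, h⟩ := h
  set b : ℝ := t * (1 + Real.log (1 / 2 : ℝ)⁻¹) with hb
  have hl2 : 0 < Real.log 2 := Real.log_pos one_lt_two
  have hb0 : 0 ≤ b := by
    rw [hb, one_div, inv_inv]; positivity
  set A : ℝ := 2 * (max (Real.log (2 * C)) 0 + b) with hA
  have hA0 : 0 ≤ A := by positivity
  refine logSumBounded_of_le (A := A / Real.log 2 + 2 * b) fun d hd => ?_
  have h1 := sum_le_two_mul_log hα hγ hγ1 (h d hd (1 / 2) (by norm_num) (by norm_num))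
  simp only [Real.rpow_one]
  have hlog2 := log_two_le_log_add_one hd
  have hd0 : (0 : ℝ) < d := by exact_mod_cast hd
  have hlogd : Real.log d ≤ Real.log ((d : ℝ) + 1) := Real.log_le_log hd0 (by linarith)
  have h2 : 2 * Real.log (2 * (C * Real.exp (t * (1 + Real.log d) *
      (1 + Real.log (1 / 2 : ℝ)⁻¹)))) ≤ A + 2 * b * Real.log d := by
    have hbd : 0 ≤ b * Real.log d := mul_nonneg hb0 (Real.log_nonneg (by exact_mod_cast hd))
    rcases hC.eq_or_lt with hC0 | hC0
    · rw [← hC0]; simp; linarith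
    · rw [← mul_assoc 2 C, Real.log_mul (by positivity) (Real.exp_pos _).ne', Real.log_exp, hA]
      have : t * (1 + Real.log d) * (1 + Real.log (1 / 2 : ℝ)⁻¹) = b + b * Real.log d := by
        rw [hb]; ring
      rw [this]
      linarith [le_max_left (Real.log (2 * C)) 0]
  have h3 : A ≤ A / Real.log 2 * Real.log ((d : ℝ) + 1) := by
    rw [div_mul_eq_mul_div, le_div_iff₀ hl2]
    exact mul_le_mul_of_nonneg_left hlog2 hA0
  have h4 : 2 * b * Real.log d ≤ 2 * b * Real.log ((d : ℝ) + 1) :=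
    mul_le_mul_of_nonneg_left hlogd (by positivity)
  linarith

theorem isWT_iff {L : InfoClass} {c : Criterion} :
    IsWT α γ L c ↔ IsWeaklyTractable 1 1 α γ L c := by
  unfold IsWT IsWeaklyTractable
  simp only [Real.rpow_one, Real.rpow_neg_one]

theorem powSumVanishes_of_isWeaklyTractable (hα : 1 < α) (hγ : ∀ j, 0 < γ j)
    (hγ1 : ∀ j, γ j ≤ 1) {σ τ : ℝ} (hσ : 0 < σ) {L : InfoClass} {c : Criterion}
    (h : IsWeaklyTractable σ τ α γ L c) : PowSumVanishes γ σ 1 := by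
  have hpath : Tendsto (fun d : ℕ => (d, (1 / 2 : ℝ))) atTop dimAccuracyFilter := by
    refine tendsto_inf.mpr ⟨tendsto_comap_iff.mpr ?_, tendsto_principal.mpr ?_⟩
    · change Tendsto (fun d : ℕ => (d : ℝ) + (1 / 2 : ℝ)⁻¹) atTop atTop
      exact tendsto_atTop_add_const_right _ _ (tendsto_natCast_atTop_atTop (R := ℝ))
    · filter_upwards [eventually_ge_atTop 1] with d hd
      exact ⟨hd, by norm_num, by norm_num⟩
  have h1 := h.comp hpath
  set K : ℝ := (1 / 2 : ℝ) ^ (-τ) with hK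
  have hK0 : 0 < K := by positivity
  have hnonneg : ∀ d : ℕ, 0 ≤ 1 / (d : ℝ) ^ σ * ∑ j ∈ Finset.range d, γ j ^ (1 : ℝ) := fun d =>
    mul_nonneg (by positivity) (Finset.sum_nonneg fun j _ => Real.rpow_nonneg (hγ j).le _)
  refine Metric.tendsto_atTop.mpr fun δ hδ => eventually_atTop.mp ?_
  have hinf : Tendsto (fun d : ℕ => (d : ℝ) ^ σ) atTop atTop :=
    (tendsto_rpow_atTop hσ).comp tendsto_natCast_atTop_atTop
  have h2 : ∀ᶠ d : ℕ in atTop, ENNReal.log (infoComplexity α γ L c d (1 / 2) : ℝ≥0∞) /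
      (((d : ℝ) ^ σ + K : ℝ) : EReal) < ((δ / 4 : ℝ) : EReal) :=
    h1.eventually_lt_const (by exact_mod_cast (by positivity : (0 : ℝ) < δ / 4))
  filter_upwards [h2, hinf.eventually_gt_atTop ((2 * Real.log 2 + δ / 2 * K) / (δ / 2)),
    eventually_ge_atTop 1] with d hd1 hd2 hd3
  have hD0 : 0 < (d : ℝ) ^ σ := Real.rpow_pos_of_pos (by exact_mod_cast hd3) _
  have hDK : 0 < (d : ℝ) ^ σ + K := by positivity
  rw [EReal.div_lt_iff (by exact_mod_cast hDK) (EReal.coe_ne_top _), ← EReal.coe_mul,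
    ← Real.log_exp (δ / 4 * _), ← ENNReal.log_ofReal_of_pos (Real.exp_pos _),
    ENNReal.log_lt_log_iff] at hd1
  have h3 := sum_le_two_mul_log hα hγ hγ1 hd1.le
  rw [Real.log_mul two_ne_zero (Real.exp_pos _).ne', Real.log_exp] at h3
  rw [div_lt_iff₀ (by positivity)] at hd2
  rw [Real.dist_eq, sub_zero, abs_of_nonneg (hnonneg d), one_div, inv_mul_lt_iff₀ hD0]
  simp only [Real.rpow_one]
  linarith

theorem powSumVanishes_mono (hγ : ∀ j, 0 < γ j) (hγ1 : ∀ j, γ j ≤ 1) {σ κ τ : ℝ} (hκτ : κ ≤ τ)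
    (h : PowSumVanishes γ σ κ) : PowSumVanishes γ σ τ := by
  refine squeeze_zero (fun d => ?_) (fun d => ?_) h
  · exact mul_nonneg (by positivity) (Finset.sum_nonneg fun j _ => Real.rpow_nonneg (hγ j).le _)
  · refine mul_le_mul_of_nonneg_left ?_ (by positivity)
    exact Finset.sum_le_sum fun j _ => Real.rpow_le_rpow_of_exponent_ge (hγ j) (hγ1 j) hκτ

theorem powSumVanishes_of_one_lt (hγ : ∀ j, 0 < γ j) (hγ1 : ∀ j, γ j ≤ 1) {σ κ : ℝ}
    (hσ : 1 < σ) (hκ : 0 ≤ κ) : PowSumVanishes γ σ κ := by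
  have h1 : Tendsto (fun d : ℕ => (d : ℝ) ^ (-(σ - 1))) atTop (𝓝 0) :=
    (tendsto_rpow_neg_atTop (by linarith)).comp tendsto_natCast_atTop_atTop
  refine tendsto_of_tendsto_of_tendsto_of_le_of_le' tendsto_const_nhds h1
    (Eventually.of_forall fun d => mul_nonneg (by positivity)
      (Finset.sum_nonneg fun j _ => Real.rpow_nonneg (hγ j).le _)) ?_
  filter_upwards [eventually_ge_atTop 1] with d hd
  have hd0 : (0 : ℝ) < d := by exact_mod_cast hd
  have h2 : ∑ j ∈ Finset.range d, γ j ^ κ ≤ d := by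
    have := Finset.sum_le_card_nsmul (Finset.range d) (fun j => γ j ^ κ) 1
      fun j _ => Real.rpow_le_one (hγ j).le (hγ1 j) hκ
    simpa using this
  calc 1 / (d : ℝ) ^ σ * ∑ j ∈ Finset.range d, γ j ^ κ ≤ 1 / (d : ℝ) ^ σ * d := by gcongr
    _ = _ := by
      rw [neg_sub, Real.rpow_sub hd0, Real.rpow_one]; ring

theorem tendsto_rpow_add_rpow_dimAccuracyFilter {σ τ : ℝ} (hσ : 0 < σ) (hτ : 0 < τ) :
    Tendsto (fun p : ℕ × ℝ => (p.1 : ℝ) ^ σ + p.2 ^ (-τ)) dimAccuracyFilter atTop := by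
  refine tendsto_atTop.mpr fun K => ?_
  obtain ⟨N, hN1, hN2⟩ := (((tendsto_rpow_atTop hσ).eventually_ge_atTop K).and
    (((tendsto_rpow_atTop hτ).eventually_ge_atTop K).and (eventually_ge_atTop (0:ℝ)))).exists
  have hev : ∀ᶠ p : ℕ × ℝ in dimAccuracyFilter, 2 * N ≤ (p.1 : ℝ) + p.2⁻¹ :=
    (tendsto_comap.mono_left inf_le_left).eventually (eventually_ge_atTop (2 * N))
  have hmem : ∀ᶠ p : ℕ × ℝ in dimAccuracyFilter, 1 ≤ p.1 ∧ 0 < p.2 ∧ p.2 < 1 :=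
    mem_inf_of_right (mem_principal_self _)
  filter_upwards [hev, hmem] with p hp1 ⟨hp2, hp3, hp4⟩
  have h1 : 0 ≤ (p.1 : ℝ) ^ σ := by positivity
  have h2 : 0 ≤ p.2 ^ (-τ) := by positivity
  rcases le_or_gt N (p.1 : ℝ) with h | h
  · linarith [Real.rpow_le_rpow hN2.2 h hσ.le]
  · have h3 : N ≤ p.2⁻¹ := by linarith
    have h4 := Real.rpow_le_rpow hN2.2 h3 hτ.le
    rw [Real.inv_rpow hp3.le, ← Real.rpow_neg hp3.le] at h4
    linarith [hN2.1]

theorem exists_sum_le_of_powSumVanishes {σ κ : ℝ} (h : PowSumVanishes γ σ κ) {δ : ℝ} (hδ : 0 < δ) :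
    ∃ K : ℝ, ∀ d : ℕ, 1 ≤ d → ∑ j ∈ Finset.range d, γ j ^ κ ≤ δ * (d : ℝ) ^ σ + K := by
  obtain ⟨N, hN⟩ := eventually_atTop.mp (h.eventually_lt_const hδ)
  refine ⟨∑ d ∈ Finset.range N, |∑ j ∈ Finset.range d, γ j ^ κ|, fun d hd => ?_⟩
  have hD0 : 0 < (d : ℝ) ^ σ := Real.rpow_pos_of_pos (by exact_mod_cast hd) _
  rcases lt_or_ge d N with hlt | hge
  · have := Finset.single_le_sum (f := fun d => |∑ j ∈ Finset.range d, γ j ^ κ|)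
      (fun _ _ => abs_nonneg _) (Finset.mem_range.mpr hlt)
    have h2 := le_abs_self (∑ j ∈ Finset.range d, γ j ^ κ)
    have h3 : 0 ≤ δ * (d : ℝ) ^ σ := by positivity
    linarith
  · have h1 := hN d hge
    rw [one_div, inv_mul_lt_iff₀ hD0] at h1
    have h2 : 0 ≤ ∑ d ∈ Finset.range N, |∑ j ∈ Finset.range d, γ j ^ κ| :=
      Finset.sum_nonneg fun _ _ => abs_nonneg _
    linarith

theorem exists_log_inv_le {τ δ : ℝ} (hτ : 0 < τ) (hδ : 0 < δ) :
    ∃ K : ℝ, ∀ ε : ℝ, 0 < ε → Real.log ε⁻¹ ≤ δ * ε ^ (-τ) + K := by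
  refine ⟨-(1 / τ) * Real.log (δ * τ), fun ε hε => ?_⟩
  have h0 : 0 < ε ^ (-τ) := by positivity
  have h1 := Real.log_le_sub_one_of_pos (show 0 < δ * τ * ε ^ (-τ) by positivity)
  rw [Real.log_mul (by positivity) h0.ne', Real.log_rpow hε] at h1
  rw [Real.log_inv]
  have h2 : -τ * Real.log ε ≤ δ * τ * ε ^ (-τ) - Real.log (δ * τ) := by linarith
  have h3 : -Real.log ε = 1 / τ * (-τ * Real.log ε) := by field_simp
  rw [h3]
  calc 1 / τ * (-τ * Real.log ε) ≤ 1 / τ * (δ * τ * ε ^ (-τ) - Real.log (δ * τ)) := by gcongr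
    _ = _ := by field_simp; ring

theorem isWeaklyTractable_of_powSumVanishes (hα : 1 < α) (hγ : ∀ j, 0 < γ j)
    (hγ1 : ∀ j, γ j ≤ 1) {σ τ κ : ℝ} (hσ : 0 < σ) (hτ : 0 < τ) (hκ1 : κ < 1)
    (h : PowSumVanishes γ σ κ) (L : InfoClass) (c : Criterion) :
    IsWeaklyTractable σ τ α γ L c := by
  have hα0 : 0 < α := by linarith
  have hα1 : 1 / α < 1 := by rw [div_lt_one hα0]; exact hα
  obtain ⟨t, ht, ht1⟩ := exists_between (max_lt hα1 hκ1)
  have hαt : 1 / α < t := (le_max_left _ _).trans_lt ht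
  have ht0 : 0 < t := lt_trans (by positivity) hαt
  have hαt' : 1 < α * t := by rwa [div_lt_iff₀' hα0] at hαt
  have hvan := powSumVanishes_mono hγ hγ1 ((le_max_right _ _).trans_lt ht).le h
  obtain ⟨C, hC, hrate⟩ := exists_minimalError_std_le ht0 ht1
  have hC0 : 0 < C := by linarith
  set r : ℝ := (1 - t) / (2 * t * (1 + t)) with hr
  have hr0 : 0 < r := div_pos (by linarith) (by positivity)
  set Z : ℝ := intZeta (α * t) with hZ
  have hZ0 : 0 ≤ Z := intZeta_nonneg _
  set S : ℕ → ℝ := fun d => ∑ j ∈ Finset.range d, γ j ^ t with hS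
  have hS0 : ∀ d, 0 ≤ S d := fun d => Finset.sum_nonneg fun j _ => Real.rpow_nonneg (hγ j).le _
  set A : ℝ := Real.log 2 + 1 / r * Real.log C with hA
  set B : ℝ := 1 / r * (Z * (1 / (2 * t))) with hB
  have hB0 : 0 ≤ B := by positivity
  have hbound : ∀ d : ℕ, ∀ ε : ℝ, 0 < ε → ε < 1 →
      ENNReal.log (infoComplexity α γ L c d ε : ℝ≥0∞) ≤
        ((A + B * S d + 1 / r * Real.log ε⁻¹ : ℝ) : EReal) := by
    intro d ε hε hε1
    have hM1 : 1 ≤ Real.exp (Z * S d) := Real.one_le_exp (mul_nonneg hZ0 (hS0 d))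
    have h1 := infoComplexity_le_of_rate (α := α) (γ := γ) (d := d) (L := L) c
      (C := C * Real.exp (Z * S d) ^ (1 / (2 * t))) (r := r) (ε := ε)
      (one_le_mul_of_one_le_of_one_le hC (Real.one_le_rpow hM1 (by positivity))) hr0 hε hε1
      fun n hn => (minimalError_le_std hα hγ L n).trans
        (hrate α γ d _ hα0 hγ hγ1 hM1 (tsum_decayProd_rpow_le hγ hαt' d) n hn)
    refine (ENNReal.log_le_log h1).trans (le_of_eq ?_)
    rw [ENNReal.log_ofReal_of_pos (by positivity)]
    congr 1
    rw [Real.log_mul two_ne_zero (by positivity), Real.log_rpow (by positivity),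
      Real.log_div (by positivity) hε.ne', Real.log_mul hC0.ne' (by positivity),
      Real.log_rpow (Real.exp_pos _), Real.log_exp, Real.log_inv, hA, hB]
    ring
  have hmem : ∀ᶠ p : ℕ × ℝ in dimAccuracyFilter, 1 ≤ p.1 ∧ 0 < p.2 ∧ p.2 < 1 :=
    mem_inf_of_right (mem_principal_self _)
  set D : ℕ × ℝ → ℝ := fun p => (p.1 : ℝ) ^ σ + p.2 ^ (-τ) with hD
  have hDpos : ∀ p : ℕ × ℝ, 0 < p.2 → 0 < D p := fun p hp => by
    have : 0 ≤ (p.1 : ℝ) ^ σ := by positivity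
    have : 0 < p.2 ^ (-τ) := by positivity
    simp only [hD]; linarith
  have hlim : Tendsto D dimAccuracyFilter atTop := tendsto_rpow_add_rpow_dimAccuracyFilter hσ hτ
  have hreal : Tendsto (fun p : ℕ × ℝ => (|A| + B * S p.1 + 1 / r * Real.log p.2⁻¹) / D p)
      dimAccuracyFilter (𝓝 0) := by
    refine Metric.tendsto_nhds.mpr fun δ hδ => ?_
    set δ₁ : ℝ := δ / (2 * (B + 1 / r)) with hδ₁
    have hBr : 0 < B + 1 / r := by positivity
    have hδ₁0 : 0 < δ₁ := by positivity
    obtain ⟨K₁, hK₁⟩ := exists_sum_le_of_powSumVanishes hvan hδ₁0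
    obtain ⟨K₂, hK₂⟩ := exists_log_inv_le hτ hδ₁0
    filter_upwards [hmem, hlim.eventually_gt_atTop ((|A| + B * K₁ + 1 / r * K₂) / (δ / 2))]
      with p ⟨hp1, hp2, hp3⟩ hp4
    have hDp := hDpos p hp2
    have hlog : 0 ≤ Real.log p.2⁻¹ := Real.log_nonneg ((one_le_inv₀ hp2).mpr hp3.le)
    have hnum : 0 ≤ |A| + B * S p.1 + 1 / r * Real.log p.2⁻¹ := by
      have := hS0 p.1
      positivity
    rw [Real.dist_eq, sub_zero, abs_of_nonneg (div_nonneg hnum hDp.le), div_lt_iff₀ hDp]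
    rw [div_lt_iff₀ (by positivity)] at hp4
    have e1 : B * S p.1 ≤ B * (δ₁ * D p + K₁) := by
      refine mul_le_mul_of_nonneg_left ((hK₁ p.1 hp1).trans ?_) hB0
      have : 0 ≤ p.2 ^ (-τ) := by positivity
      have : δ₁ * (p.1 : ℝ) ^ σ ≤ δ₁ * D p :=
        mul_le_mul_of_nonneg_left (by simp only [hD]; linarith) hδ₁0.le
      linarith
    have e2 : 1 / r * Real.log p.2⁻¹ ≤ 1 / r * (δ₁ * D p + K₂) := by
      refine mul_le_mul_of_nonneg_left ((hK₂ p.2 hp2).trans ?_) (by positivity)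
      have : 0 ≤ (p.1 : ℝ) ^ σ := by positivity
      have : δ₁ * p.2 ^ (-τ) ≤ δ₁ * D p :=
        mul_le_mul_of_nonneg_left (by simp only [hD]; linarith) hδ₁0.le
      linarith
    have e3 : (B + 1 / r) * δ₁ = δ / 2 := by
      rw [hδ₁]; field_simp
    calc _ ≤ |A| + B * (δ₁ * D p + K₁) + 1 / r * (δ₁ * D p + K₂) := by linarith
      _ = |A| + B * K₁ + 1 / r * K₂ + (B + 1 / r) * δ₁ * D p := by ring
      _ < D p * (δ / 2) + δ / 2 * D p := by rw [e3]; linarith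
      _ = δ * D p := by ring
  refine tendsto_of_tendsto_of_tendsto_of_le_of_le' tendsto_const_nhds
    ((continuous_coe_real_ereal.tendsto 0).comp hreal) ?_ ?_
  · filter_upwards [hmem] with p ⟨hp1, hp2, hp3⟩
    refine EReal.div_nonneg (ENNReal.zero_le_log_iff.mpr ?_)
      (EReal.coe_nonneg.mpr (hDpos p hp2).le)
    exact_mod_cast one_le_infoComplexity hα hγ hγ1 L c hp3
  · filter_upwards [hmem] with p ⟨hp1, hp2, hp3⟩
    have h1 := EReal.div_le_div_right_of_nonneg
      (EReal.coe_nonneg.mpr (hDpos p hp2).le) (hbound p.1 p.2 hp2 hp3)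
    refine h1.trans ?_
    rw [← EReal.coe_div]
    refine EReal.coe_le_coe_iff.mpr (div_le_div_of_nonneg_right ?_ (hDpos p hp2).le)
    linarith [le_abs_self A]

theorem isWeaklyTractable_of_uExponent_lt_one (hα : 1 < α) (hγ : ∀ j, 0 < γ j)
    (hγ1 : ∀ j, γ j ≤ 1) {σ τ : ℝ} (hσ : 0 < σ) (hτ : 0 < τ) (h : uExponent γ σ < 1)
    (L : InfoClass) (c : Criterion) : IsWeaklyTractable σ τ α γ L c := by
  obtain ⟨_, ⟨κ, ⟨_, hκ⟩, rfl⟩, hlt⟩ := sInf_lt_iff.mp h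
  exact isWeaklyTractable_of_powSumVanishes hα hγ hγ1 hσ hτ
    (EReal.coe_lt_coe_iff.mp (show ((κ : ℝ) : EReal) < ((1 : ℝ) : EReal) from hlt)) hκ L c

theorem zetaReal_nonneg {x : ℝ} (hx : 1 < x) : 0 ≤ zetaReal x := by
  unfold zetaReal
  rw [zeta_eq_tsum_one_div_nat_cpow (by simpa using hx)]
  have h1 : ∀ n : ℕ, 1 / (n : ℂ) ^ (x : ℂ) = ((1 / (n : ℝ) ^ x : ℝ) : ℂ) := fun n => by
    rw [Complex.ofReal_div, Complex.ofReal_cpow (Nat.cast_nonneg n)]; simp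
  simp only [h1]
  rw [← Complex.ofReal_tsum, Complex.ofReal_re]
  exact tsum_nonneg fun n => by positivity

end Korobov

end

theorem theorem3 (α : ℝ) (hα : 1 < α) (γ : ℕ → ℝ) (hγ_pos : ∀ j, 0 < γ j)
    (hγ_le : γ 0 ≤ 1) (hγ_anti : Antitone γ) :
    -- strong polynomial tractability
    ((∀ (L : Korobov.InfoClass) (c : Korobov.Criterion),
        Korobov.IsSPT α γ L c ↔ Korobov.sExponent γ < 1) ∧
      (Korobov.sExponent γ < 1 →
        ∀ τ : ℝ, max ((1 / α : ℝ) : EReal) (Korobov.sExponent γ) < (τ : EReal) → τ < 1 →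
          (∃ C : ℝ, ∀ d n : ℕ, 1 ≤ d → 1 ≤ n →
            Korobov.minimalError α γ d .all n ≤
              ENNReal.ofReal (C * (n : ℝ) ^ (-((1 - τ) / (2 * τ))))) ∧
          (∃ C : ℝ, ∀ d n : ℕ, 1 ≤ d → 1 ≤ n →
            Korobov.minimalError α γ d .std n ≤
              ENNReal.ofReal (C * (n : ℝ) ^ (-((1 - τ) / (2 * τ * (1 + τ)))))))) ∧
    -- polynomial tractability
    ((∀ (L : Korobov.InfoClass) (c : Korobov.Criterion),
        Korobov.IsPT α γ L c ↔ Korobov.tExponent γ < 1) ∧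
      (Korobov.tExponent γ < 1 →
        ∀ τ : ℝ, max ((1 / α : ℝ) : EReal) (Korobov.tExponent γ) < (τ : EReal) → τ < 1 →
          ∀ δ : ℝ, 0 < δ →
          (∃ C : ℝ, ∀ d n : ℕ, 1 ≤ d → 1 ≤ n →
            Korobov.minimalError α γ d .all n ≤
              ENNReal.ofReal (C * (n : ℝ) ^ (-((1 - τ) / (2 * τ))) *
                (d : ℝ) ^ (δ + Korobov.zetaReal (α * τ) * (Korobov.tExponent γ).toReal / τ))) ∧
          (∃ C : ℝ, ∀ d n : ℕ, 1 ≤ d → 1 ≤ n →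
            Korobov.minimalError α γ d .std n ≤
              ENNReal.ofReal (C * (n : ℝ) ^ (-((1 - τ) / (2 * τ * (1 + τ)))) *
                (d : ℝ) ^ (δ + Korobov.zetaReal (α * τ) * (Korobov.tExponent γ).toReal / τ))))) ∧
    -- quasi-polynomial tractability
    ((∀ (L : Korobov.InfoClass) (c : Korobov.Criterion),
        Korobov.IsQPT α γ L c → Korobov.LogSumBounded γ 1) ∧
      (Korobov.LogSumBounded γ 1 → Korobov.tExponent γ ≤ 1)) ∧
    -- weak tractability
    ((∀ (L : Korobov.InfoClass) (c : Korobov.Criterion),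
        Korobov.IsWT α γ L c → Korobov.PowSumVanishes γ 1 1) ∧
      (Korobov.PowSumVanishes γ 1 1 → Korobov.uExponent γ 1 ≤ 1) ∧
      (∀ (L : Korobov.InfoClass) (c : Korobov.Criterion),
        Korobov.uExponent γ 1 < 1 → Korobov.IsWT α γ L c)) ∧
    -- (σ,τ)-weak tractability
    ((∀ σ τ : ℝ, 0 < σ → σ ≤ 1 → 0 < τ →
        (∀ (L : Korobov.InfoClass) (c : Korobov.Criterion),
          Korobov.IsWeaklyTractable σ τ α γ L c → Korobov.PowSumVanishes γ σ 1) ∧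
        (Korobov.PowSumVanishes γ σ 1 → Korobov.uExponent γ σ ≤ 1) ∧
        (∀ (L : Korobov.InfoClass) (c : Korobov.Criterion),
          Korobov.uExponent γ σ < 1 → Korobov.IsWeaklyTractable σ τ α γ L c)) ∧
      (∀ σ τ : ℝ, 1 < σ → 0 < τ → ∀ (L : Korobov.InfoClass) (c : Korobov.Criterion),
        Korobov.IsWeaklyTractable σ τ α γ L c)) ∧
    -- uniform weak tractability
    ((∀ (L : Korobov.InfoClass) (c : Korobov.Criterion),
        Korobov.IsUWT α γ L c → ∀ σ : ℝ, 0 < σ → σ ≤ 1 → Korobov.PowSumVanishes γ σ 1) ∧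
      ((∀ σ : ℝ, 0 < σ → σ ≤ 1 → Korobov.PowSumVanishes γ σ 1) →
        ∀ σ : ℝ, 0 < σ → σ ≤ 1 → Korobov.uExponent γ σ ≤ 1) ∧
      (∀ (L : Korobov.InfoClass) (c : Korobov.Criterion),
        (∀ σ : ℝ, 0 < σ → σ ≤ 1 → Korobov.uExponent γ σ < 1) → Korobov.IsUWT α γ L c)) := by
  have hγ1 := Korobov.le_one_of_antitone hγ_le hγ_anti
  have hu : ∀ σ : ℝ, Korobov.PowSumVanishes γ σ 1 → Korobov.uExponent γ σ ≤ 1 :=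
    fun σ h => Korobov.uExponent_le one_pos h
  refine ⟨⟨Korobov.isSPT_iff hα hγ_pos hγ1 hγ_anti, fun _ τ hτ hτ1 => ?_⟩,
    ⟨Korobov.isPT_iff hα hγ_pos hγ1 hγ_anti, fun _ τ hτ hτ1 δ hδ => ?_⟩,
    ⟨fun L c h => Korobov.logSumBounded_of_isQPT hα hγ_pos hγ1 h,
      fun h => Korobov.tExponent_le one_pos h⟩,
    ⟨fun L c h => Korobov.powSumVanishes_of_isWeaklyTractable hα hγ_pos hγ1 one_pos
        (Korobov.isWT_iff.mp h), hu 1,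
      fun L c h => Korobov.isWT_iff.mpr
        (Korobov.isWeaklyTractable_of_uExponent_lt_one hα hγ_pos hγ1 one_pos one_pos h L c)⟩,
    ⟨fun σ τ hσ _ hτ =>
      ⟨fun L c h => Korobov.powSumVanishes_of_isWeaklyTractable hα hγ_pos hγ1 hσ h, hu σ,
        fun L c h => Korobov.isWeaklyTractable_of_uExponent_lt_one hα hγ_pos hγ1 hσ hτ h L c⟩,
      fun σ τ hσ hτ L c => Korobov.isWeaklyTractable_of_powSumVanishes hα hγ_pos hγ1
        (by linarith) hτ (by norm_num : (1 / 2 : ℝ) < 1)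
        (Korobov.powSumVanishes_of_one_lt hγ_pos hγ1 hσ (by norm_num)) L c⟩,
    ⟨fun L c h σ hσ hσ1 => Korobov.powSumVanishes_of_isWeaklyTractable hα hγ_pos hγ1 hσ
        (h σ 1 hσ hσ1 one_pos le_rfl),
      fun h σ hσ hσ1 => hu σ (h σ hσ hσ1),
      fun L c h σ τ hσ hσ1 hτ _ =>
        Korobov.isWeaklyTractable_of_uExponent_lt_one hα hγ_pos hγ1 hσ hτ (h σ hσ hσ1) L c⟩⟩
  · have hατ : 1 / α < τ := EReal.coe_lt_coe_iff.mp ((le_max_left _ _).trans_lt hτ)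
    obtain ⟨⟨C, _, hC⟩, C', _, hC'⟩ := Korobov.exists_rates hα hγ_pos hγ1 hατ hτ1
      (Korobov.summable_of_sExponent_lt hγ_pos hγ1 ((le_max_right _ _).trans_lt hτ))
    exact ⟨⟨C, fun d n _ hn => hC d n hn⟩, C', fun d n _ hn => hC' d n hn⟩
  · have hατ : 1 / α < τ := EReal.coe_lt_coe_iff.mp ((le_max_left _ _).trans_lt hτ)
    have hα0 : 0 < α := by linarith
    have hτ0 : 0 < τ := lt_trans (by positivity) hατ
    obtain ⟨⟨C, hC1, hC⟩, C', hC1', hC'⟩ := Korobov.exists_rates hα hγ_pos hγ1 hατ hτ1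
      (Korobov.summable_of_tExponent_lt hγ_pos hγ_anti ((le_max_right _ _).trans_lt hτ))
    have hexp : 0 ≤ δ + Korobov.zetaReal (α * τ) * (Korobov.tExponent γ).toReal / τ := by
      have h1 := Korobov.zetaReal_nonneg (x := α * τ) (by rwa [div_lt_iff₀' hα0] at hατ)
      have h2 := EReal.toReal_nonneg (Korobov.zero_le_tExponent (γ := γ))
      positivity
    have hd : ∀ d : ℕ, 1 ≤ d →
        1 ≤ (d : ℝ) ^ (δ + Korobov.zetaReal (α * τ) * (Korobov.tExponent γ).toReal / τ) :=
      fun d hd => Real.one_le_rpow (by exact_mod_cast hd) hexp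
    exact ⟨⟨C, fun d n hd1 hn => (hC d n hn).trans (ENNReal.ofReal_le_ofReal
        (le_mul_of_one_le_right (by positivity) (hd d hd1)))⟩,
      C', fun d n hd1 hn => (hC' d n hn).trans (ENNReal.ofReal_le_ofReal
        (le_mul_of_one_le_right (by positivity) (hd d hd1)))⟩
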